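/- For $E\subset\mathbb R^n$ let $\overline{\dim}_A(E)$ denote the (upper) Assouad dimension, i.e. the infimum of all $s\ge 0$ for which there is $C\ge 1$ such that for all $x\in E$ and $0<r<R<\operatorname{diam}(E)$ the set $E\cap B(x,R)$ can be covered by at most $C(r/R)^{-s}$ balls of radius $r$; let $\underline{\dim}_A(E)$ denote the lower Assouad dimension, i.e. the supremum of all $t\ge 0$ for which there is $c>0$ such that for all $x\in E$ and $0<r<R<\operatorname{diam}(E)$ at least $c(r/R)^{-t}$ balls of radius $r$ are needed to cover $E\cap B(x,R)$. (Balls are closed, with arbitrary centers in $\mathbb R^n$.) For an open set $\Omega\subset\mathbb R^n$ write $\Omega^c=\mathbb R^n\setminus\Omega$ and $d_\Omega(x)=\operatorname{dist}(x,\Omega^c)$ (with $d_\Omega\equiv\infty$, $\infty^{\beta-p}=0$ for $\beta<p$, if $\Omega=\mathbb R^n$), and let $\operatorname{Lip}_0(\Omega)$ be the set of Lipschitz functions $u\colon\Omega\to\mathbb R$ with compact support in $\Omega$. Let $1<p<\infty$ and $\beta<p-1$, and let $\Omega_0\subset\mathbb R^n$ be an open set with $\underline{\dim}_A(\Omega_0^c)>n-p+\beta$.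 Let $F\subset\overline{\Omega_0}$ be a closed set with $\overline{\dim}_A(F)<n-p+\beta$, and put $\Omega=\Omega_0\setminus F$. Then there is a constant $C>0$ such that \[ \int_{\Omega}|u(x)|^p\,d_\Omega(x)^{\beta-p}\,dx\le C\int_{\Omega}|\nabla u(x)|^p\,d_\Omega(x)^{\beta}\,dx \] for all $u\in\operatorname{Lip}_0(\Omega_0)$. -/

import Mathlib

open MeasureTheory
open scoped ENNReal NNReal

noncomputable section

/-- The set `T` of centres gives a cover of `A` by closed balls of radius `r`
(the centres may be any points of the space). -/
def CoveredByBalls {X : Type*} [PseudoMetricSpace X] (A : Set X) (r : ℝ) (T : Finset X) : Prop :=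
  A ⊆ ⋃ z ∈ T, Metric.closedBall z r

/-- `s` is admissible for the upper Assouad dimension of `E`: there is `C ≥ 1` such that for all
`x ∈ E` and `0 < r < R < diam E`, the set `E ∩ B(x, R)` can be covered by at most
`C (r / R) ^ (-s)` closed balls of radius `r`. -/
def UpperAssouadExponent {X : Type*} [PseudoMetricSpace X] (E : Set X) (s : ℝ) : Prop :=
  ∃ C : ℝ, 1 ≤ C ∧ ∀ x ∈ E, ∀ r R : ℝ, 0 < r → r < R → ENNReal.ofReal R < Metric.ediam E →
    ∃ T : Finset X, CoveredByBalls (E ∩ Metric.closedBall x R) r T ∧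
      (T.card : ℝ) ≤ C * (r / R) ^ (-s)

/-- `t` is admissible for the lower Assouad dimension of `E`: there is `c > 0` such that for all
`x ∈ E` and `0 < r < R < diam E`, at least `c (r / R) ^ (-t)` closed balls of radius `r` are
needed to cover `E ∩ B(x, R)`. -/
def LowerAssouadExponent {X : Type*} [PseudoMetricSpace X] (E : Set X) (t : ℝ) : Prop :=
  ∃ c : ℝ, 0 < c ∧ ∀ x ∈ E, ∀ r R : ℝ, 0 < r → r < R → ENNReal.ofReal R < Metric.ediam E →
    ∀ T : Finset X, CoveredByBalls (E ∩ Metric.closedBall x R) r T →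
      c * (r / R) ^ (-t) ≤ (T.card : ℝ)

/-- The (upper) Assouad dimension: the infimum of the admissible `s ≥ 0`. -/
def upperAssouadDim {X : Type*} [PseudoMetricSpace X] (E : Set X) : EReal :=
  sInf ((fun s : ℝ => (s : EReal)) '' {s : ℝ | 0 ≤ s ∧ UpperAssouadExponent E s})

/-- The lower Assouad dimension: the supremum of the admissible `t ≥ 0`. -/
def lowerAssouadDim {X : Type*} [PseudoMetricSpace X] (E : Set X) : EReal :=
  sSup ((fun t : ℝ => (t : EReal)) '' {t : ℝ | 0 ≤ t ∧ LowerAssouadExponent E t})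

/-- `Lip₀(Ω)`: functions that are Lipschitz on `Ω` and whose support, the closure of
`{x ∈ Ω | u x ≠ 0}`, is a compact subset of `Ω`. A function on `Ω` is represented by any function
on the whole space that restricts to it; the values outside `Ω` play no role. -/
def LipZero {X : Type*} [PseudoMetricSpace X] (Ω : Set X) : Set (X → ℝ) :=
  {u | (∃ K : ℝ≥0, LipschitzOnWith K u Ω) ∧
    IsCompact (closure {x | x ∈ Ω ∧ u x ≠ 0}) ∧ closure {x | x ∈ Ω ∧ u x ≠ 0} ⊆ Ω}

/-- The `(p, β)`-Hardy inequality in `Ω ⊆ ℝⁿ`, with one constant for all `u` in the class `𝓕`: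
`∫_Ω |u|^p d_Ω^(β-p) dx ≤ C ∫_Ω |∇u|^p d_Ω^β dx`, where `d_Ω(x) = dist(x, Ωᶜ)`.
Both integrals are integrals of `[0, ∞]`-valued functions. -/
def HardyInequalityFor {n : ℕ} (p β : ℝ) (Ω : Set (EuclideanSpace ℝ (Fin n)))
    (𝓕 : Set (EuclideanSpace ℝ (Fin n) → ℝ)) : Prop :=
  ∃ C : ℝ≥0, 0 < C ∧ ∀ u ∈ 𝓕,
    ∫⁻ x in Ω, ‖u x‖ₑ ^ p * Metric.infEDist x Ωᶜ ^ (β - p) ≤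
      (C : ℝ≥0∞) * ∫⁻ x in Ω, ‖gradient u x‖ₑ ^ p * Metric.infEDist x Ωᶜ ^ β

end

/-!
Hölder's inequality applied to `v = |u| ^ p` reduces the claim to the `L¹` Hardy inequality with the
exponent `γ = β - p + 1 < 0`, the finite left-hand side being absorbed. Since the distance to
`Ω₀ᶜ ∪ F` is the minimum of the two distances, it suffices to treat the two sets separately.

Near the thin set `F`, the `L¹` inequality follows from the pointwise bound of `|v|` by the Riesz
potential of `|∇v|` and the decay of the integrals of `dist(·, F) ^ (γ - 1)` over balls. Near the
thick set `E = Ω₀ᶜ`, where `v` vanishes, the Riesz kernel is improved by averaging over a Frostman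
measure on `E`, built from iterated separated sets. At distances from a bounded `E` larger than its
diameter, `E` looks like a single point, which is thin.
-/

open Metric Set Module

theorem ennreal_rpow_le_rpow_of_nonpos {x y : ℝ≥0∞} {c : ℝ} (hc : c ≤ 0) (hxy : x ≤ y) :
    y ^ c ≤ x ^ c := by
  rw [← neg_neg c, ENNReal.rpow_neg y, ENNReal.rpow_neg x]
  exact ENNReal.inv_le_inv.2 (ENNReal.rpow_le_rpow hxy (neg_nonneg.2 hc))

section Dyadic

theorem tsum_pow_mul_rpow {q s : ℝ≥0∞} (hq : q ≠ 0) (hs : s ≠ 0) (c : ℝ) :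
    ∑' j : ℕ, (q ^ j * s) ^ c = (1 - q ^ c)⁻¹ * s ^ c := by
  have hterm (j : ℕ) : (q ^ j * s) ^ c = (q ^ c) ^ j * s ^ c := by
    rw [ENNReal.mul_rpow_of_ne_zero (pow_ne_zero j hq) hs, ← ENNReal.rpow_natCast_mul,
      ← ENNReal.rpow_mul_natCast, mul_comm c]
  simp_rw [hterm, ENNReal.tsum_mul_right, ENNReal.tsum_geometric]

theorem exists_two_pow_mul_le_le {r x : ℝ≥0∞} (hr : r ≠ 0) (hrx : r ≤ x) (hx : x ≠ ∞) :
    ∃ j : ℕ, 2 ^ j * r ≤ x ∧ x ≤ 2 * (2 ^ j * r) := by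
  lift x to ℝ≥0 using hx
  lift r to ℝ≥0 using ne_top_of_le_ne_top ENNReal.coe_ne_top hrx
  norm_cast at hr hrx
  have hr_pos : 0 < r := pos_iff_ne_zero.2 hr
  obtain ⟨j, hj, hj'⟩ := exists_nat_pow_near ((one_le_div hr_pos).2 hrx) one_lt_two
  refine ⟨j, ?_, ?_⟩
  · exact_mod_cast (le_div_iff₀ hr_pos).1 hj
  · rw [div_lt_iff₀ hr_pos, pow_succ', mul_assoc] at hj'
    exact_mod_cast hj'.le

theorem exists_inv_two_pow_mul_le_le {r x : ℝ≥0∞} (hx : x ≠ 0) (hxr : x ≤ r) (hr : r ≠ ∞) :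
    ∃ j : ℕ, 2⁻¹ ^ j * (2⁻¹ * r) ≤ x ∧ x ≤ 2 * (2⁻¹ ^ j * (2⁻¹ * r)) := by
  obtain ⟨j, hj, hj'⟩ := exists_two_pow_mul_le_le hx hxr hr
  refine ⟨j, ?_, ?_⟩
  · rw [← mul_assoc, ← pow_succ, ← ENNReal.inv_pow,
      ENNReal.inv_mul_le_iff (by simp) (by finiteness), pow_succ', mul_assoc]
    exact hj'
  · rw [mul_left_comm, ENNReal.mul_inv_cancel_left two_ne_zero (by simp), ← ENNReal.inv_pow,
      ← ENNReal.mul_le_iff_le_inv (by simp) (by finiteness)]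
    exact hj

/-- The constant produced by summing a geometric series over the dyadic shells of a function whose
sublevel sets `{f ≤ r}` have measure at most `r ^ a`, when integrating `f ^ (-b)`. -/
noncomputable def dyadicConst (a b : ℝ) : ℝ≥0∞ := 2 ^ a * (1 - 2 ^ (-|a - b|))⁻¹

theorem dyadicConst_ne_top {a b : ℝ} (h : a ≠ b) : dyadicConst a b ≠ ∞ := by
  have hlt : (2 : ℝ≥0∞) ^ (-|a - b|) < 1 :=
    ENNReal.rpow_lt_one_of_one_lt_of_neg ENNReal.one_lt_two
      (neg_neg_of_pos (abs_pos.2 (sub_ne_zero.2 h)))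
  have hne : 1 - (2 : ℝ≥0∞) ^ (-|a - b|) ≠ 0 := (tsub_pos_of_lt hlt).ne'
  exact ENNReal.mul_ne_top (by simp) (ENNReal.inv_ne_top.2 hne)

variable {X : Type*} [MeasurableSpace X] {m : Measure X} {f : X → ℝ≥0∞} {A r₀ : ℝ≥0∞} {a b : ℝ}

theorem setLIntegral_iUnion_shell_rpow_neg_le {r : ℕ → ℝ≥0∞} (hb : 0 ≤ b)
    (hr₀ : ∀ j, r j ≠ 0) (hr : ∀ j, r j ≠ ∞)
    (hm : ∀ j, m {x | f x ≤ 2 * r j} ≤ A * (2 * r j) ^ a) :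
    ∫⁻ x in ⋃ j, {x | r j ≤ f x ∧ f x ≤ 2 * r j}, f x ^ (-b) ∂m ≤
      2 ^ a * A * ∑' j, r j ^ (a - b) := by
  rw [← ENNReal.tsum_mul_left]
  refine (lintegral_iUnion_le _ _).trans (ENNReal.tsum_le_tsum fun j ↦ ?_)
  calc ∫⁻ x in {x | r j ≤ f x ∧ f x ≤ 2 * r j}, f x ^ (-b) ∂m
      ≤ ∫⁻ _ in {x | r j ≤ f x ∧ f x ≤ 2 * r j}, r j ^ (-b) ∂m :=
        setLIntegral_mono measurable_const fun x hx ↦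
          ennreal_rpow_le_rpow_of_nonpos (neg_nonpos.2 hb) hx.1
    _ = r j ^ (-b) * m {x | r j ≤ f x ∧ f x ≤ 2 * r j} := setLIntegral_const _ _
    _ ≤ r j ^ (-b) * (A * (2 * r j) ^ a) := by
        gcongr
        exact (measure_mono fun x hx ↦ hx.2).trans (hm j)
    _ = 2 ^ a * A * r j ^ (a - b) := by
        rw [ENNReal.mul_rpow_of_ne_zero two_ne_zero (hr₀ j), sub_eq_add_neg,
          ENNReal.rpow_add _ _ (hr₀ j) (hr j)]
        ring

theorem setLIntegral_rpow_neg_far_le (hb : 0 < b) (hab : a < b) (hr₀ : r₀ ≠ 0)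
    (hr₀' : r₀ ≠ ∞) (hm : ∀ r, r₀ ≤ r → r ≠ ∞ → m {x | f x ≤ r} ≤ A * r ^ a) :
    ∫⁻ x in {x | r₀ ≤ f x}, f x ^ (-b) ∂m ≤ dyadicConst a b * A * r₀ ^ (a - b) := by
  set r : ℕ → ℝ≥0∞ := fun j ↦ 2 ^ j * r₀
  have hr (j : ℕ) : r j ≠ ∞ := by finiteness
  have hle (j : ℕ) : r₀ ≤ 2 * r j := by
    rw [← mul_assoc, ← pow_succ']
    exact le_mul_of_one_le_left' (one_le_pow₀ one_le_two)
  have hcover : {x | r₀ ≤ f x} ⊆ {x | f x = ∞} ∪ ⋃ j, {x | r j ≤ f x ∧ f x ≤ 2 * r j} := by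
    intro x hx
    by_cases hfx : f x = ∞
    · exact .inl hfx
    · exact .inr (mem_iUnion.2 (exists_two_pow_mul_le_le hr₀ hx hfx))
  have htop : ∫⁻ x in {x | f x = ∞}, f x ^ (-b) ∂m ≤ 0 :=
    (setLIntegral_mono measurable_zero fun x (hx : f x = ∞) ↦ by
      simp [hx, ENNReal.top_rpow_of_neg (neg_lt_zero.2 hb)]).trans_eq lintegral_zero
  calc ∫⁻ x in {x | r₀ ≤ f x}, f x ^ (-b) ∂m
      ≤ 0 + 2 ^ a * A * ∑' j, r j ^ (a - b) := by
        refine (lintegral_mono_set hcover).trans ((lintegral_union_le _ _ _).trans ?_)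
        exact add_le_add htop (setLIntegral_iUnion_shell_rpow_neg_le hb.le
          (fun j ↦ by positivity) hr fun j ↦ hm _ (hle j) (by finiteness))
    _ = dyadicConst a b * A * r₀ ^ (a - b) := by
        rw [zero_add, tsum_pow_mul_rpow two_ne_zero hr₀, dyadicConst, abs_of_neg (by linarith),
          neg_neg]
        ring

theorem measure_eq_zero_of_sublevel_le (ha : 0 < a) (hA : A ≠ ∞) (hr₀ : r₀ ≠ 0)
    (hm : ∀ r, r ≠ 0 → r ≤ r₀ → m {x | f x ≤ r} ≤ A * r ^ a) : m {x | f x = 0} = 0 := by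
  have hlim : Filter.Tendsto (fun r : ℝ≥0∞ ↦ A * r ^ a) (nhdsWithin 0 (Ioi 0)) (nhds 0) := by
    have hpow := (ENNReal.continuous_rpow_const (y := a)).tendsto 0
    rw [ENNReal.zero_rpow_of_pos ha] at hpow
    simpa using (ENNReal.Tendsto.const_mul hpow (.inr hA)).mono_left nhdsWithin_le_nhds
  refine le_antisymm (ge_of_tendsto hlim ?_) zero_le
  filter_upwards [Ioc_mem_nhdsGT (pos_iff_ne_zero.2 hr₀)] with r hr
  exact (measure_mono fun x (hx : f x = 0) ↦ hx.trans_le zero_le).trans (hm r hr.1.ne' hr.2)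

theorem setLIntegral_rpow_neg_near_le (hb : 0 ≤ b) (hab : b < a) (hA : A ≠ ∞)
    (hr₀ : r₀ ≠ 0) (hr₀' : r₀ ≠ ∞) (hm : ∀ r, r ≠ 0 → r ≤ r₀ → m {x | f x ≤ r} ≤ A * r ^ a) :
    ∫⁻ x in {x | f x ≤ r₀}, f x ^ (-b) ∂m ≤ dyadicConst a b * A * r₀ ^ (a - b) := by
  set r : ℕ → ℝ≥0∞ := fun j ↦ 2⁻¹ ^ j * (2⁻¹ * r₀)
  have hr (j : ℕ) : r j ≠ 0 := by simp [r, hr₀]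
  have hle (j : ℕ) : 2 * r j ≤ r₀ := by
    rw [mul_left_comm, ENNReal.mul_inv_cancel_left two_ne_zero (by simp)]
    exact mul_le_of_le_one_left' (pow_le_one₀ zero_le (by simp))
  have hcover : {x | f x ≤ r₀} ⊆ {x | f x = 0} ∪ ⋃ j, {x | r j ≤ f x ∧ f x ≤ 2 * r j} := by
    intro x hx
    by_cases hfx : f x = 0
    · exact .inl hfx
    · exact .inr (mem_iUnion.2 (exists_inv_two_pow_mul_le_le hfx hx hr₀'))
  have hzero : ∫⁻ x in {x | f x = 0}, f x ^ (-b) ∂m = 0 :=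
    setLIntegral_measure_zero _ _ (measure_eq_zero_of_sublevel_le (hb.trans_lt hab) hA hr₀ hm)
  calc ∫⁻ x in {x | f x ≤ r₀}, f x ^ (-b) ∂m
      ≤ 0 + 2 ^ a * A * ∑' j, r j ^ (a - b) := by
        refine (lintegral_mono_set hcover).trans ((lintegral_union_le _ _ _).trans ?_)
        exact add_le_add hzero.le (setLIntegral_iUnion_shell_rpow_neg_le hb hr
          (fun j ↦ by finiteness) fun j ↦ hm _ (mul_ne_zero two_ne_zero (hr j)) (hle j))
    _ = 2 ^ a * A * ((1 - 2⁻¹ ^ (a - b))⁻¹ * (2⁻¹ * r₀) ^ (a - b)) := by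
        rw [zero_add, tsum_pow_mul_rpow (by simp) (by simpa using hr₀)]
    _ ≤ 2 ^ a * A * ((1 - 2⁻¹ ^ (a - b))⁻¹ * r₀ ^ (a - b)) := by
        have : 2⁻¹ * r₀ ≤ r₀ := mul_le_of_le_one_left' (by simp)
        gcongr
    _ = dyadicConst a b * A * r₀ ^ (a - b) := by
        rw [dyadicConst, abs_of_pos (by linarith), ENNReal.rpow_neg, ENNReal.inv_rpow]
        ring

end Dyadic

section SegmentAverage

variable {V : Type*} [NormedAddCommGroup V] [NormedSpace ℝ V]

theorem enorm_sub_le_lintegral_enorm_fderiv {v : V → ℝ} {K : ℝ≥0} (hv : LipschitzWith K v)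
    {x y : V} (hd : ∀ᵐ t ∂volume.restrict (Ioc (0 : ℝ) 1),
      DifferentiableAt ℝ v (x + t • (y - x))) :
    ‖v x - v y‖ₑ ≤ ∫⁻ t in Ioc (0 : ℝ) 1, ‖fderiv ℝ v (x + t • (y - x))‖ₑ * ‖y - x‖ₑ := by
  set f : ℝ → ℝ := fun t ↦ v (x + t • (y - x))
  have hlip : LipschitzWith (K * ‖y - x‖₊) f := by
    refine hv.comp (LipschitzWith.of_dist_le_mul fun s t ↦ ?_)
    rw [dist_add_left, dist_eq_norm, ← sub_smul, norm_smul, mul_comm, coe_nnnorm,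
      Real.dist_eq, Real.norm_eq_abs]
  have hftc : ∫ t in Ioc (0 : ℝ) 1, deriv f t = v y - v x := by
    rw [← intervalIntegral.integral_of_le zero_le_one,
      (hlip.lipschitzOnWith (s := uIcc 0 1)).absolutelyContinuousOnInterval.integral_deriv_eq_sub]
    simp [f]
  rw [← enorm_neg, neg_sub, ← hftc]
  refine (enorm_integral_le_lintegral_enorm _).trans (lintegral_mono_ae ?_)
  filter_upwards [hd] with t ht
  have hline : HasDerivAt (fun t : ℝ ↦ x + t • (y - x)) (y - x) t := by
    simpa using ((hasDerivAt_id t).smul_const (y - x)).const_add x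
  have hchain : deriv f t = fderiv ℝ v (x + t • (y - x)) (y - x) :=
    (ht.hasFDerivAt.comp_hasDerivAt t hline).deriv
  rw [hchain]
  exact ContinuousLinearMap.le_opENorm _ _

variable [FiniteDimensional ℝ V] [MeasurableSpace V] [BorelSpace V]
  (μ : Measure V) [μ.IsAddHaarMeasure]

theorem quasiMeasurePreserving_homothety (x : V) {t : ℝ} (ht : t ≠ 0) :
    Measure.QuasiMeasurePreserving (fun y ↦ x + t • (y - x)) μ μ :=
  (measurePreserving_add_left μ x).quasiMeasurePreserving.comp
    ((Measure.quasiMeasurePreserving_smul μ ht).comp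
      (measurePreserving_sub_right μ x).quasiMeasurePreserving)

theorem ae_ae_differentiableAt_homothety {v : V → ℝ} {K : ℝ≥0} (hv : LipschitzWith K v) (x : V) :
    ∀ᵐ y ∂μ, ∀ᵐ t ∂volume.restrict (Ioc (0 : ℝ) 1),
      DifferentiableAt ℝ v (x + t • (y - x)) := by
  have hmeas : MeasurableSet {q : V × ℝ | DifferentiableAt ℝ v (x + q.2 • (q.1 - x))} :=
    measurableSet_preimage (f := fun q : V × ℝ ↦ x + q.2 • (q.1 - x)) (by fun_prop)
      (measurableSet_of_differentiableAt ℝ v)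
  rw [Measure.ae_ae_comm hmeas]
  refine (ae_restrict_iff' measurableSet_Ioc).2 (.of_forall fun t ht ↦ ?_)
  exact (quasiMeasurePreserving_homothety μ x ht.1.ne').ae hv.ae_differentiableAt

theorem lintegral_comp_homothety (x : V) {t : ℝ} (ht : 0 < t) {H : V → ℝ≥0∞} (hH : Measurable H) :
    ∫⁻ y, H (x + t • (y - x)) ∂μ =
      ENNReal.ofReal t ^ (-(finrank ℝ V : ℝ)) * ∫⁻ z, H z ∂μ := by
  calc ∫⁻ y, H (x + t • (y - x)) ∂μ
      = ∫⁻ y, H (x + t • y) ∂μ := lintegral_sub_right_eq_self (fun y ↦ H (x + t • y)) x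
    _ = ∫⁻ y, H (x + y) ∂(Measure.map (t • ·) μ) := by
        rw [lintegral_map (by fun_prop) (by fun_prop)]
    _ = ENNReal.ofReal |(t ^ finrank ℝ V)⁻¹| * ∫⁻ z, H z ∂μ := by
        rw [Measure.map_addHaar_smul μ ht.ne', lintegral_smul_measure, smul_eq_mul,
          lintegral_add_left_eq_self]
    _ = ENNReal.ofReal t ^ (-(finrank ℝ V : ℝ)) * ∫⁻ z, H z ∂μ := by
        rw [abs_of_nonneg (by positivity), ENNReal.rpow_neg, ENNReal.rpow_natCast,
          ← ENNReal.ofReal_pow ht.le, ENNReal.ofReal_inv_of_pos (by positivity)]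

variable {B : Set V} {x : V} {ρ : ℝ≥0∞}

theorem setLIntegral_comp_homothety_mul_enorm_le (hB : MeasurableSet B) (hconv : Convex ℝ B)
    (hx : x ∈ B) (hρ : ∀ y ∈ B, edist x y ≤ ρ) {g : V → ℝ≥0∞} (hg : Measurable g) {t : ℝ}
    (ht : t ∈ Ioc (0 : ℝ) 1) :
    ∫⁻ y in B, g (x + t • (y - x)) * ‖y - x‖ₑ ∂μ ≤
      ∫⁻ z in B, g z * edist x z * {s : ℝ | edist x z / ρ ≤ ENNReal.ofReal s}.indicator
        (fun s ↦ ENNReal.ofReal s ^ (-((finrank ℝ V : ℝ) + 1))) t ∂μ := by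
  set τ := ENNReal.ofReal t with hτ
  have hτ_pos : τ ≠ 0 := by simpa [hτ] using ht.1
  have hτ_top : τ ≠ ∞ := ENNReal.ofReal_ne_top
  set S : Set V := B ∩ {z | edist x z / ρ ≤ τ}
  have hS : MeasurableSet S := hB.inter (measurableSet_le (by fun_prop) measurable_const)
  set H : V → ℝ≥0∞ := S.indicator fun z ↦ g z * edist x z * τ⁻¹
  have hH : Measurable H := by fun_prop (disch := assumption)
  have hpointwise (y : V) (hy : y ∈ B) :
      g (x + t • (y - x)) * ‖y - x‖ₑ = H (x + t • (y - x)) := by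
    have hdist : edist x (x + t • (y - x)) = τ * ‖y - x‖ₑ := by
      rw [edist_comm, edist_eq_enorm_sub, add_sub_cancel_left, enorm_smul,
        Real.enorm_of_nonneg ht.1.le]
    have hmem : x + t • (y - x) ∈ S := by
      refine ⟨hconv.add_smul_sub_mem hx hy ⟨ht.1.le, ht.2⟩, ?_⟩
      rw [mem_ofPred, hdist, ← edist_eq_enorm_sub, edist_comm]
      exact ENNReal.div_le_of_le_mul (by gcongr; exact hρ y hy)
    rw [show H _ = _ from indicator_of_mem hmem _, hdist, mul_comm τ, mul_assoc, mul_assoc,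
      ENNReal.mul_inv_cancel hτ_pos hτ_top, mul_one]
  calc ∫⁻ y in B, g (x + t • (y - x)) * ‖y - x‖ₑ ∂μ
      = ∫⁻ y in B, H (x + t • (y - x)) ∂μ := setLIntegral_congr_fun hB hpointwise
    _ ≤ ∫⁻ y, H (x + t • (y - x)) ∂μ := setLIntegral_le_lintegral _ _
    _ = τ ^ (-(finrank ℝ V : ℝ)) * ∫⁻ z, H z ∂μ := lintegral_comp_homothety μ x ht.1 hH
    _ = ∫⁻ z, τ ^ (-(finrank ℝ V : ℝ)) * H z ∂μ := (lintegral_const_mul _ hH).symm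
    _ = _ := by
        rw [← lintegral_indicator hB]
        refine lintegral_congr fun z ↦ ?_
        by_cases hzB : z ∈ B <;> by_cases hzτ : edist x z / ρ ≤ τ
        · simp only [H, S, ← hτ, hzB, hzτ, mem_inter_iff, mem_ofPred_eq, and_self,
            indicator_of_mem]
          rw [neg_add, ENNReal.rpow_add _ _ hτ_pos hτ_top, ENNReal.rpow_neg_one]
          ring
        all_goals simp [H, S, ← hτ, hzB, hzτ]

theorem setLIntegral_Ioc_rpow_neg_le {d : ℝ} (hd : 0 < d) {a : ℝ≥0∞} (ha : a ≠ 0) (ha' : a ≠ ∞) :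
    ∫⁻ t in Ioc (0 : ℝ) 1, {s : ℝ | a ≤ ENNReal.ofReal s}.indicator
      (fun s ↦ ENNReal.ofReal s ^ (-(d + 1))) t ≤ dyadicConst 1 (d + 1) * a ^ (-d) := by
  rw [lintegral_indicator (measurableSet_le measurable_const (by fun_prop))]
  have hsublevel (r : ℝ≥0∞) (hr : r ≠ ∞) :
      volume.restrict (Ioc (0 : ℝ) 1) {t | ENNReal.ofReal t ≤ r} ≤ 1 * r ^ (1 : ℝ) := by
    rw [Measure.restrict_apply (measurableSet_le (by fun_prop) measurable_const)]
    calc volume ({t | ENNReal.ofReal t ≤ r} ∩ Ioc (0 : ℝ) 1)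
        ≤ volume (Icc 0 r.toReal) := measure_mono fun t ht ↦
          ⟨ht.2.1.le, (ENNReal.ofReal_le_iff_le_toReal hr).1 ht.1⟩
      _ = 1 * r ^ (1 : ℝ) := by simp [ENNReal.ofReal_toReal hr]
  refine (setLIntegral_rpow_neg_far_le (by linarith) (by linarith) ha ha'
    fun r _ hr ↦ hsublevel r hr).trans_eq ?_
  rw [mul_one, sub_add_cancel_right]

theorem mul_setLIntegral_Ioc_rpow_neg_le {d : ℝ} (hd : 0 < d) {e ρ : ℝ≥0∞} (he : e ≠ ∞)
    (hρ₀ : ρ ≠ 0) (hρ_top : ρ ≠ ∞) :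
    e * ∫⁻ t in Ioc (0 : ℝ) 1, {s : ℝ | e / ρ ≤ ENNReal.ofReal s}.indicator
      (fun s ↦ ENNReal.ofReal s ^ (-(d + 1))) t ≤
        dyadicConst 1 (d + 1) * ρ ^ d * e ^ (1 - d) := by
  by_cases he₀ : e = 0
  · simp [he₀]
  calc _ ≤ e * (dyadicConst 1 (d + 1) * (e / ρ) ^ (-d)) := by
        gcongr
        exact setLIntegral_Ioc_rpow_neg_le hd (ENNReal.div_ne_zero.2 ⟨he₀, hρ_top⟩)
          (ENNReal.div_ne_top he hρ₀)
    _ = dyadicConst 1 (d + 1) * ρ ^ d * e ^ (1 - d) := by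
        rw [div_eq_mul_inv, ENNReal.mul_rpow_of_ne_top he (by simpa using hρ₀),
          ENNReal.inv_rpow, ← ENNReal.rpow_neg, neg_neg, sub_eq_add_neg,
          ENNReal.rpow_add _ _ he₀ he, ENNReal.rpow_one]
        ring

theorem setLIntegral_enorm_sub_le [Nontrivial V] (hB : MeasurableSet B) (hconv : Convex ℝ B)
    (hx : x ∈ B) (hρ₀ : ρ ≠ 0) (hρ_top : ρ ≠ ∞) (hρ : ∀ y ∈ B, edist x y ≤ ρ) {v : V → ℝ}
    {K : ℝ≥0} (hv : LipschitzWith K v) :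
    ∫⁻ y in B, ‖v x - v y‖ₑ ∂μ ≤
      dyadicConst 1 (finrank ℝ V + 1) * ρ ^ (finrank ℝ V : ℝ) *
        ∫⁻ z in B, ‖fderiv ℝ v z‖ₑ * edist x z ^ (1 - (finrank ℝ V : ℝ)) ∂μ := by
  set n : ℝ := (finrank ℝ V : ℝ)
  have hn : 0 < n := Nat.cast_pos.2 finrank_pos
  set g : V → ℝ≥0∞ := fun z ↦ ‖fderiv ℝ v z‖ₑ
  have hg : Measurable g := (measurable_fderiv ℝ v).enorm
  set κ : ℝ → V → ℝ≥0∞ := fun t z ↦ {s : ℝ | edist x z / ρ ≤ ENNReal.ofReal s}.indicator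
    (fun s ↦ ENNReal.ofReal s ^ (-(n + 1))) t
  have hκ : Measurable (Function.uncurry κ) :=
    Measurable.indicator (f := fun q : ℝ × V ↦ ENNReal.ofReal q.1 ^ (-(n + 1)))
      (s := {q : ℝ × V | edist x q.2 / ρ ≤ ENNReal.ofReal q.1}) (by fun_prop)
      (measurableSet_le (by fun_prop) (by fun_prop))
  calc ∫⁻ y in B, ‖v x - v y‖ₑ ∂μ
      ≤ ∫⁻ y in B, ∫⁻ t in Ioc (0 : ℝ) 1, g (x + t • (y - x)) * ‖y - x‖ₑ ∂volume ∂μ :=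
        lintegral_mono_ae <| (ae_restrict_of_ae (ae_ae_differentiableAt_homothety μ hv x)).mono
          fun y hy ↦ enorm_sub_le_lintegral_enorm_fderiv hv hy
    _ = ∫⁻ t in Ioc (0 : ℝ) 1, ∫⁻ y in B, g (x + t • (y - x)) * ‖y - x‖ₑ ∂μ :=
        lintegral_lintegral_swap (by fun_prop)
    _ ≤ ∫⁻ t in Ioc (0 : ℝ) 1, ∫⁻ z in B, g z * edist x z * κ t z ∂μ :=
        setLIntegral_mono' measurableSet_Ioc fun t ht ↦
          setLIntegral_comp_homothety_mul_enorm_le μ hB hconv hx hρ hg ht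
    _ = ∫⁻ z in B, ∫⁻ t in Ioc (0 : ℝ) 1, g z * edist x z * κ t z ∂volume ∂μ :=
        lintegral_lintegral_swap (by fun_prop)
    _ ≤ ∫⁻ z in B, dyadicConst 1 (n + 1) * ρ ^ n * (g z * edist x z ^ (1 - n)) ∂μ := by
        refine lintegral_mono fun z ↦ ?_
        rw [lintegral_const_mul _ hκ.of_uncurry_right, mul_assoc (g z), mul_left_comm _ (g z)]
        exact mul_le_mul_right
          (mul_setLIntegral_Ioc_rpow_neg_le hn (edist_ne_top x z) hρ₀ hρ_top) _
    _ = _ := lintegral_const_mul _ (by fun_prop)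

end SegmentAverage

theorem exists_mem_edist_le_two_mul {X : Type*} [PseudoEMetricSpace X] {F : Set X} {x : X}
    {ε : ℝ≥0∞} (hε : ε ≠ 0) (hε' : ε ≠ ∞) (hx : infEDist x F ≤ ε) : ∃ y ∈ F, edist x y ≤ 2 * ε := by
  have hlt : infEDist x F < 2 * ε := by
    rw [two_mul]
    exact hx.trans_lt (ENNReal.lt_add_right hε' hε)
  obtain ⟨y, hy, hxy⟩ := infEDist_lt_iff.1 hlt
  exact ⟨y, hy, hxy.le⟩

theorem closedEBall_inter_infEDist_le_subset {X : Type*} [PseudoEMetricSpace X] {F : Set X}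
    {w x₀ y : X} {R ε : ℝ≥0∞} {T : Finset X} (hε : ε ≠ 0) (hε' : ε ≠ ∞) (hεR : ε ≤ R)
    (hx₀y : edist x₀ y ≤ R) (hx₀w : edist x₀ w ≤ 2 * ε)
    (hT : F ∩ closedEBall w (6 * R) ⊆ ⋃ z ∈ T, closedEBall z ε) :
    closedEBall y R ∩ {x | infEDist x F ≤ ε} ⊆ ⋃ z ∈ T, closedEBall z (3 * ε) := by
  rintro x ⟨hxy, hxF⟩
  obtain ⟨f, hf, hxf⟩ := exists_mem_edist_le_two_mul hε hε' hxF
  have hfw : edist f w ≤ 6 * R := by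
    calc edist f w ≤ edist f x + edist x x₀ + edist x₀ w := edist_triangle4 _ _ _ _
      _ ≤ edist x f + (edist x y + edist x₀ y) + edist x₀ w := by
          rw [edist_comm f x]
          gcongr
          exact edist_triangle_right _ _ _
      _ ≤ 2 * R + (R + R) + 2 * R := by
          gcongr
          exacts [hxf.trans (by gcongr), hxy, hx₀w.trans (by gcongr)]
      _ = 6 * R := by ring
  obtain ⟨z, hz, hfz⟩ := mem_iUnion₂.1 (hT ⟨hf, hfw⟩)
  refine mem_iUnion₂.2 ⟨z, hz, ?_⟩
  calc edist x z ≤ edist x f + edist f z := edist_triangle _ _ _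
    _ ≤ 2 * ε + ε := add_le_add hxf hfz
    _ = 3 * ε := by ring

theorem CoveredByBalls.exists_refinement {X : Type*} [PseudoMetricSpace X] {A : Set X}
    {M : Finset X} {δ r N : ℝ} (hM : CoveredByBalls A δ M)
    (h : ∀ z ∈ M, ∃ T : Finset X, CoveredByBalls (A ∩ closedBall z δ) r T ∧ (T.card : ℝ) ≤ N) :
    ∃ T : Finset X, CoveredByBalls A r T ∧ (T.card : ℝ) ≤ M.card * N := by
  classical
  choose! T hT hT_card using h
  refine ⟨M.biUnion T, fun y hy ↦ ?_, ?_⟩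
  · obtain ⟨z, hz, hyz⟩ := mem_iUnion₂.1 (hM hy)
    obtain ⟨w, hw, hyw⟩ := mem_iUnion₂.1 (hT z hz ⟨hy, hyz⟩)
    exact mem_iUnion₂.2 ⟨w, Finset.mem_biUnion.2 ⟨z, hz, hw⟩, hyw⟩
  · calc ((M.biUnion T).card : ℝ) ≤ ∑ z ∈ M, ((T z).card : ℝ) := by
          exact_mod_cast Finset.card_biUnion_le
      _ ≤ ∑ _ ∈ M, N := Finset.sum_le_sum hT_card
      _ = M.card * N := by rw [Finset.sum_const, nsmul_eq_mul]

section UpperAssouad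

variable {X : Type*} [PseudoMetricSpace X] [ProperSpace X] {F : Set X} {s : ℝ}

theorem exists_coveredByBalls_of_isBounded {δ : ℝ} (hF : Bornology.IsBounded F) (hδ : 0 < δ) :
    ∃ M : Finset X, ↑M ⊆ F ∧ CoveredByBalls F δ M := by
  obtain ⟨M, hMF, hM_fin, hM⟩ := (hF.isCompact_closure.totallyBounded.subset
    subset_closure).exists_subset (dist_mem_uniformity hδ)
  refine ⟨hM_fin.toFinset, by simpa using hMF, fun y hy ↦ ?_⟩
  obtain ⟨z, hz, hyz⟩ := mem_iUnion₂.1 (hM hy)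
  exact mem_iUnion₂.2 ⟨z, by simpa using hz, (show dist y z < δ from hyz).le⟩

theorem UpperAssouadExponent.exists_cover_of_isBounded (hs : 0 ≤ s)
    (h : UpperAssouadExponent F s) (hF : Bornology.IsBounded F) :
    ∃ C : ℝ, ∀ r R : ℝ, 0 < r → r < R → diam F ≤ R →
      ∃ T : Finset X, CoveredByBalls F r T ∧ (T.card : ℝ) ≤ C * (R / r) ^ s := by
  obtain ⟨C, hC_one, hC⟩ := h
  set D := diam F
  have hD : ediam F = ENNReal.ofReal D :=
    (ENNReal.ofReal_toReal (isBounded_iff_ediam_ne_top.1 hF)).symm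
  rcases F.eq_empty_or_nonempty with rfl | ⟨x, hx⟩
  · exact ⟨0, fun r R _ _ _ ↦ ⟨∅, by simp [CoveredByBalls], by simp⟩⟩
  rcases (show 0 ≤ D from diam_nonneg).eq_or_lt with hD₀ | hD_pos
  · refine ⟨1, fun r R hr hrR _ ↦ ⟨{x}, fun y hy ↦ ?_, ?_⟩⟩
    · simpa using (dist_le_diam_of_mem hF hy hx).trans (hD₀.ge.trans hr.le)
    · simpa using Real.one_le_rpow ((one_le_div hr).2 hrR.le) hs
  obtain ⟨M, hMF, hM⟩ := exists_coveredByBalls_of_isBounded hF (half_pos hD_pos)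
  refine ⟨M.card * C, fun r R hr hrR hDR ↦ ?_⟩
  have hR_pow : 1 ≤ (R / r) ^ s := Real.one_le_rpow ((one_le_div hr).2 hrR.le) hs
  rw [mul_assoc]
  rcases le_or_gt (D / 2) r with hDr | hrD
  · exact ⟨M, hM.trans (iUnion₂_mono fun z _ ↦ closedBall_subset_closedBall hDr),
      le_mul_of_one_le_right (Nat.cast_nonneg _) (one_le_mul_of_one_le_of_one_le hC_one hR_pow)⟩
  refine hM.exists_refinement fun z hz ↦ ?_
  obtain ⟨T, hT, hT_card⟩ := hC z (hMF hz) r (D / 2) hr hrD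
    (hD ▸ (ENNReal.ofReal_lt_ofReal_iff hD_pos).2 (half_lt_self hD_pos))
  refine ⟨T, hT, hT_card.trans ?_⟩
  rw [Real.rpow_neg_eq_inv_rpow, inv_div]
  gcongr
  linarith

theorem UpperAssouadExponent.exists_cover (hs : 0 ≤ s) (h : UpperAssouadExponent F s) :
    ∃ C : ℝ, ∀ x ∈ F, ∀ r R : ℝ, 0 < r → r < R →
      ∃ T : Finset X, CoveredByBalls (F ∩ closedBall x R) r T ∧
        (T.card : ℝ) ≤ C * (R / r) ^ s := by
  obtain ⟨C, -, hC⟩ := id h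
  have hsmall : ∀ x ∈ F, ∀ r R : ℝ, 0 < r → r < R → ENNReal.ofReal R < ediam F →
      ∃ T : Finset X, CoveredByBalls (F ∩ closedBall x R) r T ∧
        (T.card : ℝ) ≤ C * (R / r) ^ s := by
    intro x hx r R hr hrR hR
    obtain ⟨T, hT, hT_card⟩ := hC x hx r R hr hrR hR
    rw [Real.rpow_neg_eq_inv_rpow, inv_div] at hT_card
    exact ⟨T, hT, hT_card⟩
  by_cases hF : Bornology.IsBounded F
  · obtain ⟨C', hC'⟩ := h.exists_cover_of_isBounded hs hF
    refine ⟨max C C', fun x hx r R hr hrR ↦ ?_⟩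
    have hR_pos : 0 < R := hr.trans hrR
    have hpow : 0 ≤ (R / r) ^ s := by positivity
    by_cases hR : diam F ≤ R
    · obtain ⟨T, hT, hT_card⟩ := hC' r R hr hrR hR
      exact ⟨T, inter_subset_left.trans hT,
        hT_card.trans (mul_le_mul_of_nonneg_right (le_max_right _ _) hpow)⟩
    · obtain ⟨T, hT, hT_card⟩ := hsmall x hx r R hr hrR <|
        (ENNReal.ofReal_lt_iff_lt_toReal (by linarith) (isBounded_iff_ediam_ne_top.1 hF)).2
          (not_le.1 hR)
      exact ⟨T, hT, hT_card.trans (mul_le_mul_of_nonneg_right (le_max_left _ _) hpow)⟩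
  · refine ⟨C, fun x hx r R hr hrR ↦ hsmall x hx r R hr hrR ?_⟩
    rw [ediam_of_unbounded hF]
    exact ENNReal.ofReal_lt_top

theorem UpperAssouadExponent.exists_cover_inter_infEDist_le (hs : 0 ≤ s)
    (h : UpperAssouadExponent F s) :
    ∃ C : ℝ≥0∞, C ≠ ∞ ∧ ∀ (y : X) (R ε : ℝ≥0∞), ε ≠ 0 → ε ≤ R → R ≠ ∞ →
      ∃ T : Finset X, closedEBall y R ∩ {x | infEDist x F ≤ ε} ⊆ ⋃ z ∈ T, closedEBall z (3 * ε) ∧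
        (T.card : ℝ≥0∞) ≤ C * R ^ s * ε ^ (-s) := by
  obtain ⟨C, hC⟩ := h.exists_cover hs
  refine ⟨ENNReal.ofReal C * 6 ^ s, by finiteness, fun y R ε hε hεR hR ↦ ?_⟩
  have hε' : ε ≠ ∞ := ne_top_of_le_ne_top hR hεR
  rcases (closedEBall y R ∩ {x | infEDist x F ≤ ε}).eq_empty_or_nonempty with
    hempty | ⟨x₀, hx₀y, hx₀F⟩
  · exact ⟨∅, by simp [hempty], by simp⟩
  obtain ⟨w, hwF, hxw⟩ := exists_mem_edist_le_two_mul hε hε' hx₀F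
  lift R to ℝ≥0 using hR
  lift ε to ℝ≥0 using hε'
  norm_cast at hε hεR
  have hε_pos : 0 < ε := pos_iff_ne_zero.2 hε
  have hεR' : ε < 6 * R := by
    refine hεR.trans_lt (lt_mul_of_one_lt_left (hε_pos.trans_le hεR) (by norm_num))
  obtain ⟨T, hT, hT_card⟩ := hC w hwF ε ((6 * R : ℝ≥0) : ℝ) hε_pos (by exact_mod_cast hεR')
  refine ⟨T, ?_, ?_⟩
  · refine closedEBall_inter_infEDist_le_subset (by exact_mod_cast hε) (by simp)
      (by exact_mod_cast hεR) hx₀y hxw ?_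
    simpa only [CoveredByBalls, ← closedEBall_coe, ENNReal.coe_mul, ENNReal.coe_ofNat] using hT
  · calc (T.card : ℝ≥0∞) = ENNReal.ofReal T.card := by simp
      _ ≤ ENNReal.ofReal (C * (((6 * R : ℝ≥0) : ℝ) / ε) ^ s) := ENNReal.ofReal_le_ofReal hT_card
      _ = ENNReal.ofReal C * 6 ^ s * R ^ s * ε ^ (-s) := by
        rw [ENNReal.ofReal_mul' (by positivity), ← NNReal.coe_div, ← NNReal.coe_rpow,
          ENNReal.ofReal_coe_nnreal, ENNReal.coe_rpow_of_nonneg _ hs, ENNReal.coe_div hε,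
          div_eq_mul_inv, ENNReal.mul_rpow_of_nonneg _ _ hs, ENNReal.coe_mul,
          ENNReal.mul_rpow_of_nonneg _ _ hs, ENNReal.inv_rpow, ENNReal.rpow_neg]
        simp only [ENNReal.coe_ofNat, mul_assoc]

end UpperAssouad

section UpperAssouadIntegral

variable {V : Type*} [NormedAddCommGroup V] [NormedSpace ℝ V] [FiniteDimensional ℝ V]
  [MeasurableSpace V] [BorelSpace V] (μ : Measure V) [μ.IsAddHaarMeasure] {F : Set V} {s : ℝ}

theorem addHaar_closedEBall (y : V) {r : ℝ≥0∞} (hr : r ≠ ∞) :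
    μ (closedEBall y r) = μ (ball 0 1) * r ^ (finrank ℝ V : ℝ) := by
  lift r to ℝ≥0 using hr
  rw [closedEBall_coe, Measure.addHaar_closedBall μ y r.coe_nonneg, mul_comm,
    ENNReal.rpow_natCast, ENNReal.ofReal_pow r.coe_nonneg, ENNReal.ofReal_coe_nnreal]

theorem UpperAssouadExponent.exists_addHaar_inter_infEDist_le (hs : 0 ≤ s)
    (h : UpperAssouadExponent F s) :
    ∃ C : ℝ≥0∞, C ≠ ∞ ∧ ∀ (y : V) (R ε : ℝ≥0∞), ε ≠ 0 → ε ≤ R → R ≠ ∞ →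
      μ (closedEBall y R ∩ {x | infEDist x F ≤ ε}) ≤
        C * R ^ s * ε ^ ((finrank ℝ V : ℝ) - s) := by
  set n : ℝ := (finrank ℝ V : ℝ)
  have hn : 0 ≤ n := Nat.cast_nonneg _
  obtain ⟨C, hC_top, hC⟩ := h.exists_cover_inter_infEDist_le hs
  have hω : μ (ball 0 1) ≠ ∞ := measure_ball_lt_top.ne
  refine ⟨C * μ (ball 0 1) * 3 ^ n, by finiteness, fun y R ε hε hεR hR ↦ ?_⟩
  have hε' : ε ≠ ∞ := ne_top_of_le_ne_top hR hεR
  obtain ⟨T, hT, hT_card⟩ := hC y R ε hε hεR hR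
  calc μ (closedEBall y R ∩ {x | infEDist x F ≤ ε})
      ≤ ∑ z ∈ T, μ (closedEBall z (3 * ε)) :=
        (measure_mono hT).trans (measure_biUnion_finset_le _ _)
    _ = T.card * (μ (ball 0 1) * (3 * ε) ^ n) := by
        rw [Finset.sum_congr rfl fun z _ ↦ addHaar_closedEBall μ z (by finiteness),
          Finset.sum_const, nsmul_eq_mul]
    _ ≤ C * R ^ s * ε ^ (-s) * (μ (ball 0 1) * (3 * ε) ^ n) := by gcongr
    _ = C * μ (ball 0 1) * 3 ^ n * R ^ s * ε ^ (n - s) := by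
        rw [ENNReal.mul_rpow_of_nonneg _ _ hn, sub_eq_add_neg, ENNReal.rpow_add _ _ hε hε']
        ring

theorem UpperAssouadExponent.exists_setLIntegral_closedEBall_infEDist_rpow_neg_le {b : ℝ}
    (hs : 0 ≤ s) (h : UpperAssouadExponent F s) (hb : 0 ≤ b) (hbs : b < (finrank ℝ V : ℝ) - s) :
    ∃ C : ℝ≥0∞, C ≠ ∞ ∧ ∀ (y : V) (R : ℝ≥0∞), R ≠ 0 → R ≠ ∞ →
      ∫⁻ x in closedEBall y R, infEDist x F ^ (-b) ∂μ ≤ C * R ^ ((finrank ℝ V : ℝ) - b) := by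
  set n : ℝ := (finrank ℝ V : ℝ)
  obtain ⟨C, hC_top, hC⟩ := h.exists_addHaar_inter_infEDist_le μ hs
  have hω : μ (ball 0 1) ≠ ∞ := measure_ball_lt_top.ne
  have hκ : dyadicConst (n - s) b ≠ ∞ := dyadicConst_ne_top hbs.ne'
  refine ⟨dyadicConst (n - s) b * C + μ (ball 0 1), by finiteness, fun y R hR hR_top ↦ ?_⟩
  have hmeas : MeasurableSet {x : V | infEDist x F ≤ R} :=
    measurableSet_le (by fun_prop) measurable_const
  have hnear : ∫⁻ x in {x | infEDist x F ≤ R}, infEDist x F ^ (-b) ∂μ.restrict (closedEBall y R) ≤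
      dyadicConst (n - s) b * (C * R ^ s) * R ^ (n - s - b) := by
    refine setLIntegral_rpow_neg_near_le hb hbs (by finiteness) hR hR_top fun r hr hrR ↦ ?_
    rw [Measure.restrict_apply (measurableSet_le (by fun_prop) measurable_const), inter_comm]
    exact hC y R r hr hrR hR_top
  have hfar : ∫⁻ x in {x | infEDist x F ≤ R}ᶜ, infEDist x F ^ (-b) ∂μ.restrict (closedEBall y R) ≤
      R ^ (-b) * (μ (ball 0 1) * R ^ n) := by
    calc _ ≤ ∫⁻ _ in {x | infEDist x F ≤ R}ᶜ, R ^ (-b) ∂μ.restrict (closedEBall y R) :=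
          setLIntegral_mono measurable_const fun x hx ↦
            ennreal_rpow_le_rpow_of_nonpos (neg_nonpos.2 hb) (not_le.1 (notMem_of_mem_compl hx)).le
      _ ≤ ∫⁻ _, R ^ (-b) ∂μ.restrict (closedEBall y R) := setLIntegral_le_lintegral _ _
      _ = R ^ (-b) * (μ (ball 0 1) * R ^ n) := by
          rw [lintegral_const, Measure.restrict_apply_univ, addHaar_closedEBall μ y hR_top]
  rw [← lintegral_add_compl _ hmeas]
  refine (add_le_add hnear hfar).trans_eq ?_
  rw [mul_left_comm (R ^ (-b)), ← ENNReal.rpow_add _ _ hR hR_top, ← mul_assoc _ C,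
    mul_assoc _ (R ^ s), ← ENNReal.rpow_add _ _ hR hR_top, add_mul]
  ring_nf

end UpperAssouadIntegral

/-- The compactly supported Lipschitz functions on `V` whose support lies in `Ω`. Extending the
members of `LipZero Ω` by zero gives such functions. -/
def lipCc {V : Type*} [PseudoMetricSpace V] (Ω : Set V) : Set (V → ℝ) :=
  {v | (∃ K : ℝ≥0, LipschitzWith K v) ∧ HasCompactSupport v ∧ tsupport v ⊆ Ω}

/-- The `L¹` Hardy inequality with weight exponent `γ` for the distance to `A`, with one constant
for all functions of the class `𝓕`. -/
def L1HardyFor {V : Type*} [NormedAddCommGroup V] [NormedSpace ℝ V] [MeasurableSpace V]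
    (μ : Measure V) (γ : ℝ) (A : Set V) (𝓕 : Set (V → ℝ)) : Prop :=
  ∃ C : ℝ≥0∞, C ≠ ∞ ∧ ∀ v ∈ 𝓕,
    ∫⁻ x, ‖v x‖ₑ * infEDist x A ^ (γ - 1) ∂μ ≤
      C * ∫⁻ x, ‖fderiv ℝ v x‖ₑ * infEDist x A ^ γ ∂μ

theorem lintegral_mul_le_of_le_lintegral_kernel {α β : Type*} [MeasurableSpace α]
    [MeasurableSpace β] {μ : Measure α} {ν : Measure β} [SFinite μ] [SFinite ν]
    {k : α → β → ℝ≥0∞} {u W : α → ℝ≥0∞} {g w : β → ℝ≥0∞} {C₁ C₂ : ℝ≥0∞}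
    (hk : Measurable (Function.uncurry k)) (hW : Measurable W) (hg : Measurable g)
    (hw : Measurable w) (hu : ∀ᵐ x ∂μ, u x ≤ C₁ * ∫⁻ z, g z * k x z ∂ν)
    (hkW : ∀ z, ∫⁻ x, W x * k x z ∂μ ≤ C₂ * w z) :
    ∫⁻ x, u x * W x ∂μ ≤ C₁ * C₂ * ∫⁻ z, g z * w z ∂ν := by
  have hkx (x : α) : Measurable (k x) := hk.comp measurable_prodMk_left
  have hkz (z : β) : Measurable fun x ↦ k x z := hk.comp measurable_prodMk_right
  have hgWk : Measurable (Function.uncurry fun x z ↦ g z * (W x * k x z)) :=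
    (hg.comp measurable_snd).mul ((hW.comp measurable_fst).mul hk)
  calc ∫⁻ x, u x * W x ∂μ
      ≤ ∫⁻ x, C₁ * ∫⁻ z, g z * (W x * k x z) ∂ν ∂μ := by
        refine lintegral_mono_ae (hu.mono fun x hx ↦ (mul_le_mul_left hx _).trans_eq ?_)
        rw [mul_assoc, ← lintegral_mul_const _ (by fun_prop)]
        simp only [mul_assoc, mul_comm (k x _)]
    _ = C₁ * ∫⁻ x, ∫⁻ z, g z * (W x * k x z) ∂ν ∂μ :=
        lintegral_const_mul _ hgWk.lintegral_prod_right'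
    _ = C₁ * ∫⁻ z, g z * ∫⁻ x, W x * k x z ∂μ ∂ν := by
        rw [lintegral_lintegral_swap hgWk.aemeasurable]
        congr 1
        exact lintegral_congr fun z ↦ lintegral_const_mul _ (hW.mul (hkz z))
    _ ≤ C₁ * ∫⁻ z, C₂ * (g z * w z) ∂ν := by
        gcongr _ * ?_
        refine lintegral_mono fun z ↦ ?_
        rw [mul_left_comm]
        exact mul_le_mul_right (hkW z) _
    _ = C₁ * C₂ * ∫⁻ z, g z * w z ∂ν := by
        rw [lintegral_const_mul _ (by fun_prop), mul_assoc]

theorem measure_le_two_mul_measure_sdiff {α : Type*} [MeasurableSpace α] {μ : Measure α}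
    {B S : Set α} (hS : MeasurableSet S) (hB : μ B ≠ ∞) (h : 2 * μ S ≤ μ B) :
    μ B ≤ 2 * μ (B \ S) := by
  refine (ENNReal.add_le_add_iff_left hB).1 ?_
  calc μ B + μ B = 2 * (μ (B ∩ S) + μ (B \ S)) := by rw [measure_inter_add_sdiff B hS, two_mul]
    _ ≤ 2 * μ S + 2 * μ (B \ S) := by
        rw [mul_add]
        gcongr
        exact inter_subset_right
    _ ≤ μ B + 2 * μ (B \ S) := by gcongr

theorem le_infEDist_of_edist_le {X : Type*} [PseudoEMetricSpace X] {E : Set X} {x z : X} {r : ℝ≥0∞}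
    (hr : r ≠ ∞) (hz : 2 * r ≤ infEDist z E) (hxz : edist x z ≤ r) : r ≤ infEDist x E := by
  refine (ENNReal.add_le_add_iff_right hr).1 ?_
  calc r + r ≤ infEDist z E := by rwa [← two_mul]
    _ ≤ infEDist x E + edist z x := infEDist_le_infEDist_add_edist
    _ ≤ infEDist x E + r := by gcongr; rwa [edist_comm]

section Thin

variable {V : Type*} [NormedAddCommGroup V] [NormedSpace ℝ V] [FiniteDimensional ℝ V]
  [MeasurableSpace V] [BorelSpace V] (μ : Measure V) [μ.IsAddHaarMeasure]

theorem le_mul_of_mul_addHaar_closedEBall_le {a A r : ℝ≥0∞} {x : V} (hr : r ≠ 0) (hr' : r ≠ ∞)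
    (h : a * μ (closedEBall x r) ≤ A * r ^ (finrank ℝ V : ℝ)) : a ≤ (μ (ball 0 1))⁻¹ * A := by
  have hω : μ (ball 0 1) ≠ ∞ := measure_ball_lt_top.ne
  have hω₀ : μ (ball 0 1) ≠ 0 := (measure_ball_pos μ 0 one_pos).ne'
  have hrn : r ^ (finrank ℝ V : ℝ) ≠ 0 := (ENNReal.rpow_pos (pos_iff_ne_zero.2 hr) hr').ne'
  rw [addHaar_closedEBall μ x hr', ← mul_assoc,
    ENNReal.mul_le_mul_iff_left hrn (by finiteness)] at h
  rwa [← ENNReal.mul_le_iff_le_inv hω₀ hω, mul_comm]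

theorem setLIntegral_compl_closedEBall_infEDist_rpow_mul_edist_rpow_le {F : Set V} {s γ : ℝ}
    (hs : 0 ≤ s) (h : UpperAssouadExponent F s) (hγ : γ < 0)
    (hsγ : s < (finrank ℝ V : ℝ) - 1 + γ) :
    ∃ C : ℝ≥0∞, C ≠ ∞ ∧ ∀ (z : V) (r : ℝ≥0∞), r ≠ 0 → r ≠ ∞ →
      ∫⁻ x in (closedEBall z r)ᶜ,
        infEDist x F ^ (γ - 1) * edist x z ^ (1 - (finrank ℝ V : ℝ)) ∂μ ≤ C * r ^ γ := by
  set n : ℝ := (finrank ℝ V : ℝ)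
  obtain ⟨C, hC_top, hC⟩ :=
    h.exists_setLIntegral_closedEBall_infEDist_rpow_neg_le μ hs (b := 1 - γ) (by linarith)
      (by linarith)
  have hκ : dyadicConst (n - (1 - γ)) (n - 1) ≠ ∞ := dyadicConst_ne_top (by linarith)
  refine ⟨dyadicConst (n - (1 - γ)) (n - 1) * C, by finiteness, fun z r hr hr' ↦ ?_⟩
  have hfar := setLIntegral_rpow_neg_far_le (m := μ.withDensity fun x ↦ infEDist x F ^ (γ - 1))
    (f := fun x ↦ edist x z) (A := C) (a := n - (1 - γ)) (b := n - 1) (by linarith) (by linarith)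
    hr hr' fun R hrR hR ↦ by
      rw [withDensity_apply _ (measurableSet_le (by fun_prop) measurable_const)]
      simpa only [neg_sub, closedEBall] using hC z R ((pos_iff_ne_zero.2 hr).trans_le hrR).ne' hR
  rw [restrict_withDensity (measurableSet_le measurable_const (by fun_prop)),
    lintegral_withDensity_eq_lintegral_mul _ (by fun_prop) (by fun_prop), neg_sub,
    show n - (1 - γ) - (n - 1) = γ by ring] at hfar
  refine le_trans (lintegral_mono_set fun x (hx : ¬ edist x z ≤ r) ↦ ?_) hfar
  exact (not_le.1 hx).le

variable [Nontrivial V]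

theorem exists_le_addHaar_closedEBall {a : ℝ≥0∞} (ha : a ≠ ∞) :
    ∃ R : ℝ≥0∞, R ≠ 0 ∧ R ≠ ∞ ∧ ∀ x, a ≤ μ (closedEBall x R) := by
  have hω : μ (ball 0 1) ≠ ∞ := measure_ball_lt_top.ne
  have hω₀ : μ (ball 0 1) ≠ 0 := (measure_ball_pos μ 0 one_pos).ne'
  have hQ : a * (μ (ball 0 1))⁻¹ + 1 ≠ ∞ := by finiteness
  have hR : (a * (μ (ball 0 1))⁻¹ + 1) ^ (finrank ℝ V : ℝ)⁻¹ ≠ ∞ := by finiteness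
  refine ⟨_, (ENNReal.rpow_pos (by simp) hQ).ne', hR, fun x ↦ ?_⟩
  rw [addHaar_closedEBall μ x hR, ENNReal.rpow_inv_rpow (Nat.cast_pos.2 finrank_pos).ne', mul_add,
    mul_left_comm, ENNReal.mul_inv_cancel hω₀ hω, mul_one]
  exact le_self_add

theorem exists_enorm_le_lintegral_enorm_fderiv_mul_edist_rpow :
    ∃ C : ℝ≥0∞, C ≠ ∞ ∧ ∀ (v : V → ℝ) (K : ℝ≥0), LipschitzWith K v →
      μ (Function.support v) ≠ ∞ → ∀ x,
        ‖v x‖ₑ ≤ C * ∫⁻ z, ‖fderiv ℝ v z‖ₑ * edist x z ^ (1 - (finrank ℝ V : ℝ)) ∂μ := by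
  set n : ℝ := (finrank ℝ V : ℝ)
  have hω₀ : μ (ball 0 1) ≠ 0 := (measure_ball_pos μ 0 one_pos).ne'
  have hκ : dyadicConst 1 (n + 1) ≠ ∞ :=
    dyadicConst_ne_top (lt_add_of_pos_left 1 (Nat.cast_pos.2 finrank_pos)).ne
  refine ⟨(μ (ball 0 1))⁻¹ * (2 * dyadicConst 1 (n + 1)), by finiteness, fun v K hv hsupp x ↦ ?_⟩
  set S := Function.support v
  obtain ⟨R, hR₀, hR_top, hR⟩ := exists_le_addHaar_closedEBall μ (a := 2 * μ S) (by finiteness)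
  set B := closedEBall x R
  have hB : MeasurableSet B := isClosed_closedEBall.measurableSet
  have hB_top : μ B ≠ ∞ := by rw [addHaar_closedEBall μ x hR_top]; finiteness
  have hS : MeasurableSet S := measurableSet_support hv.continuous.measurable
  rw [mul_assoc]
  refine le_mul_of_mul_addHaar_closedEBall_le μ (x := x) hR₀ hR_top ?_
  calc ‖v x‖ₑ * μ B ≤ 2 * (‖v x‖ₑ * μ (B \ S)) := by
        rw [mul_left_comm]
        gcongr
        exact measure_le_two_mul_measure_sdiff hS hB_top (hR x)
    _ = 2 * ∫⁻ y in B \ S, ‖v x - v y‖ₑ ∂μ := by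
        rw [← setLIntegral_const]
        congr 1
        refine setLIntegral_congr_fun (hB.diff hS) fun y hy ↦ ?_
        rw [Function.notMem_support.1 hy.2, sub_zero]
    _ ≤ 2 * ∫⁻ y in B, ‖v x - v y‖ₑ ∂μ := by gcongr; exact sdiff_subset
    _ ≤ 2 * (dyadicConst 1 (n + 1) * R ^ n *
          ∫⁻ z, ‖fderiv ℝ v z‖ₑ * edist x z ^ (1 - n) ∂μ) := by
        gcongr
        refine (setLIntegral_enorm_sub_le μ hB (convex_closedEBall x R) mem_closedEBall_self
          hR₀ hR_top (fun y hy ↦ by rwa [edist_comm]) hv).trans ?_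
        gcongr
        exact Measure.restrict_le_self
    _ = 2 * dyadicConst 1 (n + 1) *
          (∫⁻ z, ‖fderiv ℝ v z‖ₑ * edist x z ^ (1 - n) ∂μ) * R ^ n := by ring

theorem setLIntegral_closedEBall_infEDist_rpow_mul_edist_rpow_le {E : Set V} {z : V} {r : ℝ≥0∞}
    {γ : ℝ} (hγ : γ ≤ 1) (hr : r ≠ 0) (hr' : r ≠ ∞) (hE : 2 * r ≤ infEDist z E) :
    ∫⁻ x in closedEBall z r, infEDist x E ^ (γ - 1) * edist x z ^ (1 - (finrank ℝ V : ℝ)) ∂μ ≤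
      dyadicConst (finrank ℝ V) (finrank ℝ V - 1) * μ (ball 0 1) * r ^ γ := by
  set n : ℝ := (finrank ℝ V : ℝ)
  have hn : 1 ≤ n := Nat.one_le_cast.2 finrank_pos
  calc _ ≤ ∫⁻ x in closedEBall z r, r ^ (γ - 1) * edist x z ^ (-(n - 1)) ∂μ := by
        refine setLIntegral_mono (by fun_prop) fun x hx ↦ ?_
        rw [neg_sub]
        gcongr ?_ * _
        exact ennreal_rpow_le_rpow_of_nonpos (by linarith)
          (le_infEDist_of_edist_le hr' hE hx)
    _ = r ^ (γ - 1) * ∫⁻ x in closedEBall z r, edist x z ^ (-(n - 1)) ∂μ :=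
        lintegral_const_mul _ (by fun_prop)
    _ ≤ r ^ (γ - 1) * (dyadicConst n (n - 1) * μ (ball 0 1) * r ^ (n - (n - 1))) := by
        gcongr
        exact setLIntegral_rpow_neg_near_le (by linarith) (by linarith) measure_ball_lt_top.ne
          hr hr' fun r' _ hr'r ↦ (addHaar_closedEBall μ z (ne_top_of_le_ne_top hr' hr'r)).le
    _ = dyadicConst n (n - 1) * μ (ball 0 1) * r ^ γ := by
        rw [mul_left_comm, ← ENNReal.rpow_add _ _ hr hr']
        ring_nf

theorem UpperAssouadExponent.exists_lintegral_infEDist_rpow_mul_edist_rpow_le {F : Set V}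
    {s γ : ℝ} (hs : 0 ≤ s) (h : UpperAssouadExponent F s) (hγ : γ < 0)
    (hsγ : s < (finrank ℝ V : ℝ) - 1 + γ) :
    ∃ C : ℝ≥0∞, C ≠ ∞ ∧ ∀ z : V,
      ∫⁻ x, infEDist x F ^ (γ - 1) * edist x z ^ (1 - (finrank ℝ V : ℝ)) ∂μ ≤
        C * infEDist z F ^ γ := by
  set n : ℝ := (finrank ℝ V : ℝ)
  obtain ⟨C, hC_top, hC⟩ :=
    setLIntegral_compl_closedEBall_infEDist_rpow_mul_edist_rpow_le μ hs h hγ hsγ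
  have hω : μ (ball 0 1) ≠ ∞ := measure_ball_lt_top.ne
  have hκ : dyadicConst n (n - 1) ≠ ∞ := dyadicConst_ne_top (by linarith)
  have hγ₂ : (2⁻¹ : ℝ≥0∞) ^ γ ≠ ∞ := ENNReal.rpow_ne_top_of_ne_zero (by simp) (by simp)
  set D : ℝ≥0∞ := (dyadicConst n (n - 1) * μ (ball 0 1) + C) * 2⁻¹ ^ γ
  have hD : D ≠ ∞ := ENNReal.mul_ne_top (by finiteness) hγ₂
  refine ⟨D + 1, by finiteness, fun z ↦ ?_⟩
  rcases F.eq_empty_or_nonempty with rfl | hF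
  · simp [ENNReal.top_rpow_of_neg (show γ - 1 < 0 by linarith)]
  have hd : infEDist z F ≠ ∞ := infEDist_ne_top hF
  rcases eq_or_ne (infEDist z F) 0 with hd₀ | hd₀
  · rw [hd₀, ENNReal.zero_rpow_of_neg hγ, ENNReal.mul_top (by simp)]
    exact le_top
  set r := 2⁻¹ * infEDist z F
  have hr : r ≠ 0 := mul_ne_zero (by simp) hd₀
  have hr' : r ≠ ∞ := by finiteness
  have hrF : 2 * r = infEDist z F :=
    ENNReal.mul_inv_cancel_left two_ne_zero (by simp)
  rw [← lintegral_add_compl _ (isClosed_closedEBall (a := z) (r := r)).measurableSet]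
  calc _ ≤ dyadicConst n (n - 1) * μ (ball 0 1) * r ^ γ + C * r ^ γ :=
        add_le_add (setLIntegral_closedEBall_infEDist_rpow_mul_edist_rpow_le μ (by linarith) hr hr'
          hrF.le) (hC z r hr hr')
    _ = D * infEDist z F ^ γ := by
        rw [ENNReal.mul_rpow_of_ne_zero (by simp) hd₀]
        ring
    _ ≤ (D + 1) * infEDist z F ^ γ := by gcongr; exact le_self_add

theorem UpperAssouadExponent.l1HardyFor {F : Set V} {s γ : ℝ} (hs : 0 ≤ s)
    (h : UpperAssouadExponent F s) (hγ : γ < 0) (hsγ : s < (finrank ℝ V : ℝ) - 1 + γ) :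
    L1HardyFor μ γ F {v | (∃ K : ℝ≥0, LipschitzWith K v) ∧ μ (Function.support v) ≠ ∞} := by
  obtain ⟨C₁, hC₁_top, hC₁⟩ :=
    exists_enorm_le_lintegral_enorm_fderiv_mul_edist_rpow μ
  obtain ⟨C₂, hC₂_top, hC₂⟩ :=
    h.exists_lintegral_infEDist_rpow_mul_edist_rpow_le μ hs hγ hsγ
  refine ⟨C₁ * C₂, by finiteness, ?_⟩
  rintro v ⟨⟨K, hv⟩, hsupp⟩
  exact lintegral_mul_le_of_le_lintegral_kernel
    (k := fun x z ↦ edist x z ^ (1 - (finrank ℝ V : ℝ))) (by fun_prop) (by fun_prop)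
    (measurable_fderiv ℝ v).enorm (by fun_prop) (.of_forall (hC₁ v K hv hsupp)) hC₂

end Thin

/-- A Frostman measure on `E ∩ B(y, ρ)` of dimension `t` above the scale `η`: a probability measure
carried by `E ∩ B(y, ρ)` that gives every ball of radius `r ≥ η` mass at most `C (r / ρ) ^ t`. -/
structure IsFrostmanMeasure {X : Type*} [PseudoMetricSpace X] [MeasurableSpace X] (E : Set X)
    (C : ℝ≥0∞) (t : ℝ) (y : X) (ρ η : ℝ) (m : Measure X) : Prop where
  isProbabilityMeasure : IsProbabilityMeasure m
  ae_mem : ∀ᵐ w ∂m, w ∈ E ∩ closedBall y ρ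
  measure_closedBall_le (z : X) (r : ℝ) :
    η ≤ r → m (closedBall z r) ≤ C * ENNReal.ofReal (r / ρ) ^ t

section Frostman

variable {X : Type*} [PseudoMetricSpace X]

theorem exists_separated_of_le_card_cover {A : Set X} {r : ℝ} (hr : 0 ≤ r) {N : ℕ}
    (h : ∀ T : Finset X, CoveredByBalls A r T → N ≤ T.card) :
    ∃ T : Finset X, ↑T ⊆ A ∧ T.card = N ∧ (T : Set X).Pairwise fun x y ↦ r < dist x y := by
  classical
  suffices H : ∀ k ≤ N, ∃ T : Finset X, ↑T ⊆ A ∧ T.card = k ∧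
      (T : Set X).Pairwise fun x y ↦ r < dist x y from H N le_rfl
  intro k
  induction k with
  | zero => exact fun _ ↦ ⟨∅, by simp⟩
  | succ k ih =>
    intro hk
    obtain ⟨T, hTA, hT_card, hT_sep⟩ := ih (by lia)
    obtain ⟨a, haA, ha⟩ := not_subset.1 fun hT : CoveredByBalls A r T ↦ by linarith [h T hT]
    have hfar (x : X) (hx : x ∈ T) : r < dist a x := by
      simp only [mem_iUnion, mem_closedBall, not_exists, not_le] at ha
      exact ha x hx
    have haT : a ∉ T := fun haT ↦ (hfar a haT).not_ge (by rwa [dist_self])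
    refine ⟨insert a T, ?_, by rw [Finset.card_insert_of_notMem haT, hT_card], ?_⟩
    · rw [Finset.coe_insert]
      exact insert_subset haA hTA
    · rw [Finset.coe_insert]
      exact hT_sep.insert fun x hx _ ↦ ⟨hfar x hx, dist_comm a x ▸ hfar x hx⟩

theorem LowerAssouadExponent.exists_separated {E : Set X} {t t₀ : ℝ} (htt : t < t₀)
    (h : LowerAssouadExponent E t₀) :
    ∃ l : ℝ, 0 < l ∧ l ≤ 1 / 16 ∧ ∀ y ∈ E, ∀ ρ : ℝ, 0 < ρ → ENNReal.ofReal ρ < ediam E →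
      ∃ T : Finset X, ↑T ⊆ E ∩ closedBall y (ρ / 2) ∧ l ^ (-t) ≤ T.card ∧
        (T : Set X).Pairwise fun x y ↦ 4 * (l * ρ) < dist x y := by
  obtain ⟨c, hc_pos, hc⟩ := h
  set q : ℝ := c * 8 ^ (-t₀)
  have hq : 0 < q := by positivity
  obtain ⟨l, hl, hl_le, hlq⟩ : ∃ l : ℝ, 0 < l ∧ l ≤ 1 / 16 ∧ l ^ (t₀ - t) ≤ q := by
    refine ⟨min (1 / 16) (q ^ (t₀ - t)⁻¹), by positivity, min_le_left _ _, ?_⟩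
    calc _ ≤ (q ^ (t₀ - t)⁻¹) ^ (t₀ - t) :=
          Real.rpow_le_rpow (by positivity) (min_le_right _ _) (by linarith)
      _ = q := Real.rpow_inv_rpow hq.le (by linarith)
  have hl_card : l ^ (-t) ≤ c * (8 * l) ^ (-t₀) := by
    calc l ^ (-t) = l ^ (t₀ - t) * l ^ (-t₀) := by rw [← Real.rpow_add hl]; ring_nf
      _ ≤ q * l ^ (-t₀) := by gcongr
      _ = c * (8 * l) ^ (-t₀) := by rw [Real.mul_rpow (by norm_num) hl.le, ← mul_assoc]
  refine ⟨l, hl, hl_le, fun y hy ρ hρ hρE ↦ ?_⟩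
  have hlρ : l * ρ ≤ ρ / 16 := by nlinarith
  obtain ⟨T, hTE, hT_card, hT_sep⟩ := exists_separated_of_le_card_cover
    (A := E ∩ closedBall y (ρ / 2)) (r := 4 * (l * ρ)) (N := ⌈l ^ (-t)⌉₊) (by positivity)
    fun T hT ↦ Nat.ceil_le.2 <| by
      have hcard := hc y hy (4 * (l * ρ)) (ρ / 2) (by positivity) (by linarith)
        ((ENNReal.ofReal_le_ofReal (by linarith)).trans_lt hρE) T hT
      rw [show 4 * (l * ρ) / (ρ / 2) = 8 * l by field_simp; norm_num] at hcard
      exact hl_card.trans hcard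
  exact ⟨T, hTE, hT_card ▸ Nat.le_ceil _, hT_sep⟩

theorem sum_measure_closedBall_le_of_separated [MeasurableSpace X] {T : Finset X}
    {m : X → Measure X} {s r : ℝ} {D : ℝ≥0∞} {z : X} (hm : ∀ i ∈ T, ∀ᵐ w ∂m i, dist w i ≤ s)
    (hT : (T : Set X).Pairwise fun x y ↦ 2 * (s + r) < dist x y)
    (hD : ∀ i ∈ T, m i (closedBall z r) ≤ D) : ∑ i ∈ T, m i (closedBall z r) ≤ D := by
  have hnear (i : X) (hi : i ∈ T) (hne : m i (closedBall z r) ≠ 0) : dist i z ≤ s + r := by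
    contrapose! hne
    have hnull : m i {w | ¬ dist w i ≤ s} = 0 := hm i hi
    refine measure_mono_null (fun w hw (hws : dist w i ≤ s) ↦ hne.not_ge ?_) hnull
    linarith [dist_triangle_left i z w, mem_closedBall.1 hw]
  by_cases hall : ∀ i ∈ T, m i (closedBall z r) = 0
  · rw [Finset.sum_eq_zero hall]
    exact zero_le
  push Not at hall
  obtain ⟨i, hi, hne⟩ := hall
  rw [Finset.sum_eq_single_of_mem i hi]
  · exact hD i hi
  · intro j hj hji
    by_contra hne'
    linarith [hT hj hi hji, hnear i hi hne, hnear j hj hne', dist_triangle_right j i z]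

theorem IsFrostmanMeasure.sum_measure_closedBall_le [MeasurableSpace X] {E : Set X} {C : ℝ≥0∞}
    {t l ρ η r : ℝ} {T : Finset X} {m : X → Measure X} (ht : 0 ≤ t) (hl : 0 < l) (hρ : 0 < ρ)
    (hT_card : l ^ (-t) ≤ T.card) (hT : (T : Set X).Pairwise fun x y ↦ 4 * (l * ρ) < dist x y)
    (hm : ∀ i ∈ T, IsFrostmanMeasure E C t i (l * ρ) η (m i)) (hr : η ≤ r) (hrl : r < l * ρ)
    (z : X) :
    ∑ i ∈ T, m i (closedBall z r) ≤ T.card * (C * ENNReal.ofReal (r / ρ) ^ t) := by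
  calc ∑ i ∈ T, m i (closedBall z r) ≤ C * ENNReal.ofReal (r / (l * ρ)) ^ t :=
        sum_measure_closedBall_le_of_separated (s := l * ρ)
          (fun i hi ↦ (hm i hi).ae_mem.mono fun w hw ↦ hw.2)
          (hT.mono' fun _ _ h ↦ by linarith) fun i hi ↦ (hm i hi).measure_closedBall_le z r hr
    _ = ENNReal.ofReal (l ^ (-t)) * (C * ENNReal.ofReal (r / ρ) ^ t) := by
        rw [show r / (l * ρ) = l⁻¹ * (r / ρ) by field_simp, ENNReal.ofReal_mul (by positivity),
          ENNReal.mul_rpow_of_nonneg _ _ ht, ENNReal.ofReal_rpow_of_pos (inv_pos.2 hl),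
          Real.inv_rpow hl.le, ← Real.rpow_neg hl.le]
        ring
    _ ≤ T.card * (C * ENNReal.ofReal (r / ρ) ^ t) := by
        gcongr
        exact ENNReal.ofReal_le_of_le_toReal (by simpa using hT_card)

theorem IsFrostmanMeasure.average [MeasurableSpace X] {E : Set X} {C : ℝ≥0∞} {t l ρ η : ℝ}
    {y : X} {T : Finset X} {m : X → Measure X} (ht : 0 ≤ t) (hl : 0 < l) (hl_le : l ≤ 1 / 2)
    (hC : 1 ≤ C * ENNReal.ofReal l ^ t) (hρ : 0 < ρ) (hT_card : l ^ (-t) ≤ T.card)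
    (hTy : ∀ i ∈ T, dist i y ≤ ρ / 2) (hT : (T : Set X).Pairwise fun x y ↦ 4 * (l * ρ) < dist x y)
    (hm : ∀ i ∈ T, IsFrostmanMeasure E C t i (l * ρ) η (m i)) :
    IsFrostmanMeasure E C t y ρ η ((T.card : ℝ≥0∞)⁻¹ • ∑ i ∈ T, m i) := by
  have hN : (T.card : ℝ≥0∞) ≠ 0 := by
    have : (0 : ℝ) < T.card := (Real.rpow_pos_of_pos hl _).trans_le hT_card
    exact_mod_cast this.ne'
  have hN' : (T.card : ℝ≥0∞) ≠ ∞ := ENNReal.natCast_ne_top _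
  set M : Measure X := (T.card : ℝ≥0∞)⁻¹ • ∑ i ∈ T, m i with hM
  have hM_apply (A : Set X) : M A = (T.card : ℝ≥0∞)⁻¹ * ∑ i ∈ T, m i A := by
    rw [hM, Measure.smul_apply, Measure.finsetSum_apply, smul_eq_mul]
  have hM_prob : IsProbabilityMeasure M := ⟨by
    rw [hM_apply, Finset.sum_congr rfl fun i hi ↦ (hm i hi).isProbabilityMeasure.measure_univ,
      Finset.sum_const, nsmul_eq_mul, mul_one, ENNReal.inv_mul_cancel hN hN']⟩
  refine ⟨hM_prob, ?_, fun z r hr ↦ ?_⟩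
  · rw [ae_iff, hM_apply, Finset.sum_eq_zero, mul_zero]
    intro i hi
    rw [← ae_iff]
    filter_upwards [(hm i hi).ae_mem] with w hw
    refine ⟨hw.1, ?_⟩
    rw [mem_closedBall]
    nlinarith [dist_triangle w i y, mem_closedBall.1 hw.2, hTy i hi]
  rcases le_or_gt (l * ρ) r with hlr | hrl
  · refine prob_le_one.trans (hC.trans ?_)
    gcongr
    exact (le_div_iff₀ hρ).2 hlr
  rw [hM_apply, ENNReal.inv_mul_le_iff hN hN']
  exact sum_measure_closedBall_le ht hl hρ hT_card hT hm hr hrl z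

theorem LowerAssouadExponent.exists_isFrostmanMeasure [MeasurableSpace X]
    [MeasurableSingletonClass X] {E : Set X} {t t₀ : ℝ} (ht : 0 ≤ t) (htt : t < t₀)
    (h : LowerAssouadExponent E t₀) :
    ∃ C : ℝ≥0∞, C ≠ ∞ ∧ ∀ y ∈ E, ∀ ρ : ℝ, 0 < ρ → ENNReal.ofReal ρ < ediam E →
      ∀ η : ℝ, 0 < η → ∃ m : Measure X, IsFrostmanMeasure E C t y ρ η m := by
  obtain ⟨l, hl, hl_le, hsep⟩ := h.exists_separated htt
  have hl₀ : ENNReal.ofReal l ≠ 0 := by simpa using hl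
  set C : ℝ≥0∞ := ENNReal.ofReal l ^ (-t)
  have hC_top : C ≠ ∞ := ENNReal.rpow_ne_top_of_ne_zero hl₀ ENNReal.ofReal_ne_top
  have hC : C * ENNReal.ofReal l ^ t = 1 := by
    rw [← ENNReal.rpow_add _ _ hl₀ ENNReal.ofReal_ne_top, neg_add_cancel, ENNReal.rpow_zero]
  suffices hscale : ∀ k : ℕ, ∀ y ∈ E, ∀ ρ η : ℝ, 0 < ρ → ENNReal.ofReal ρ < ediam E →
      l ^ k * ρ ≤ η → ∃ m : Measure X, IsFrostmanMeasure E C t y ρ η m by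
    refine ⟨C, hC_top, fun y hy ρ hρ hρE η hη ↦ ?_⟩
    obtain ⟨k, hk⟩ := exists_pow_lt_of_lt_one (div_pos hη hρ) (by linarith : l < 1)
    exact hscale k y hy ρ η hρ hρE ((lt_div_iff₀ hρ).1 hk).le
  intro k
  induction k with
  | zero =>
    intro y hy ρ η hρ _ hη
    refine ⟨Measure.dirac y, inferInstance, ?_, fun z r hr ↦ ?_⟩
    · rw [ae_dirac_eq]
      exact ⟨hy, mem_closedBall_self hρ.le⟩
    · refine prob_le_one.trans (hC.symm.trans_le ?_)
      gcongr
      exact (le_div_iff₀ hρ).2 (by nlinarith)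
  | succ k ih =>
    intro y hy ρ η hρ hρE hη
    obtain ⟨T, hTE, hT_card, hT⟩ := hsep y hy ρ hρ hρE
    have hlρE : ENNReal.ofReal (l * ρ) < ediam E :=
      (ENNReal.ofReal_le_ofReal (by nlinarith)).trans_lt hρE
    choose! m hm using fun i (hi : i ∈ T) ↦
      ih i (hTE hi).1 (l * ρ) η (by positivity) hlρE (by rwa [← mul_assoc, ← pow_succ])
    exact ⟨_, .average ht hl (by linarith) hC.ge hρ hT_card (fun i hi ↦ (hTE hi).2) hT hm⟩

theorem LowerAssouadExponent.exists_isFrostmanMeasure_lintegral_edist_rpow_le [MeasurableSpace X]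
    [MeasurableSingletonClass X] {E : Set X} {t t₀ b : ℝ} (ht : 0 ≤ t) (htt : t < t₀)
    (htb : t < b) (h : LowerAssouadExponent E t₀) :
    ∃ C : ℝ≥0∞, C ≠ ∞ ∧ ∀ y ∈ E, ∀ ρ : ℝ, 0 < ρ → ENNReal.ofReal ρ < ediam E →
      ∀ η : ℝ≥0, η ≠ 0 → ∃ m : Measure X, IsProbabilityMeasure m ∧
        (∀ᵐ w ∂m, w ∈ E ∩ closedBall y ρ) ∧ ∀ z, η ≤ infEDist z E →
          ∫⁻ w, edist w z ^ (-b) ∂m ≤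
            C * ENNReal.ofReal ρ ^ (-t) * infEDist z E ^ (t - b) := by
  obtain ⟨C, hC_top, hC⟩ := h.exists_isFrostmanMeasure ht htt
  have hκ : dyadicConst t b ≠ ∞ := dyadicConst_ne_top htb.ne
  refine ⟨dyadicConst t b * C, by finiteness, fun y hy ρ hρ hρE η hη ↦ ?_⟩
  obtain ⟨m, hm⟩ := hC y hy ρ hρ hρE η (NNReal.coe_pos.2 (pos_iff_ne_zero.2 hη))
  refine ⟨m, hm.isProbabilityMeasure, hm.ae_mem, fun z hz ↦ ?_⟩
  have hrestrict : m.restrict {w | infEDist z E ≤ edist w z} = m := by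
    refine Measure.restrict_eq_self_of_ae_mem (hm.ae_mem.mono fun w hw ↦ ?_)
    rw [mem_ofPred_eq, edist_comm]
    exact infEDist_le_edist_of_mem hw.1
  have hz₀ : infEDist z E ≠ 0 := (lt_of_lt_of_le (by simpa using pos_iff_ne_zero.2 hη) hz).ne'
  have hfar := setLIntegral_rpow_neg_far_le (m := m) (f := fun w ↦ edist w z)
    (A := C * ENNReal.ofReal ρ ^ (-t)) (ht.trans_lt htb) htb hz₀ (infEDist_ne_top ⟨y, hy⟩)
    fun r hr hr' ↦ by
      lift r to ℝ≥0 using hr'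
      change m (closedEBall z r) ≤ _
      rw [closedEBall_coe]
      refine (hm.measure_closedBall_le z r (by exact_mod_cast hz.trans hr)).trans_eq ?_
      rw [ENNReal.ofReal_div_of_pos hρ, div_eq_mul_inv, ENNReal.mul_rpow_of_nonneg _ _ ht,
        ENNReal.inv_rpow, ← ENNReal.rpow_neg, ENNReal.ofReal_coe_nnreal]
      ring
  rwa [hrestrict, ← mul_assoc (dyadicConst t b)] at hfar

end Frostman

/-- The kernel of the potential of `‖fderiv ℝ v‖` that dominates a function `v` vanishing on a
set `E` of lower Assouad dimension larger than `t`: the Riesz kernel, truncated at twice the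
distance to `E`, plus the contribution of a Frostman measure on `E` near `x`. -/
noncomputable def thickKernel {V : Type*} [NormedAddCommGroup V] [NormedSpace ℝ V] (E : Set V)
    (t : ℝ) (x z : V) : ℝ≥0∞ :=
  {z | edist x z ≤ 2 * infEDist x E}.indicator (fun z ↦ edist x z ^ (1 - (finrank ℝ V : ℝ)) +
    infEDist x E ^ (-t) * infEDist z E ^ (t + 1 - (finrank ℝ V : ℝ))) z

section Thick

variable {V : Type*} [NormedAddCommGroup V] [NormedSpace ℝ V] {E : Set V} {t : ℝ}

theorem thickKernel_le_of_edist_le {x z : V} {r : ℝ≥0∞} (hr : r ≠ 0) (hr' : r ≠ ∞) (ht : 0 ≤ t)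
    (htn : t ≤ (finrank ℝ V : ℝ) - 1) (hz : 2 * r ≤ infEDist z E) (hxz : edist x z ≤ r) :
    thickKernel E t x z ≤ 2 * edist x z ^ (1 - (finrank ℝ V : ℝ)) := by
  set n : ℝ := (finrank ℝ V : ℝ)
  have hxE : r ≤ infEDist x E := le_infEDist_of_edist_le hr' hz hxz
  have hzE : r ≤ infEDist z E := (le_mul_of_one_le_left' one_le_two).trans hz
  refine (indicator_le_self' (fun _ _ ↦ zero_le) z).trans ?_
  rw [two_mul]
  refine add_le_add le_rfl ?_
  calc infEDist x E ^ (-t) * infEDist z E ^ (t + 1 - n) ≤ r ^ (-t) * r ^ (t + 1 - n) :=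
        mul_le_mul' (ennreal_rpow_le_rpow_of_nonpos (by linarith) hxE)
          (ennreal_rpow_le_rpow_of_nonpos (by linarith) hzE)
    _ = r ^ (1 - n) := by rw [← ENNReal.rpow_add _ _ hr hr']; ring_nf
    _ ≤ edist x z ^ (1 - n) := ennreal_rpow_le_rpow_of_nonpos (by linarith) hxz

theorem infEDist_rpow_mul_thickKernel_le_of_le_edist {x z : V} {r : ℝ≥0∞} {γ : ℝ} (hr : r ≠ 0)
    (hγ : γ ≤ 1) (ht : 0 ≤ t) (htn : t ≤ (finrank ℝ V : ℝ) - 1) (hz : r ≤ infEDist z E)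
    (hxz : r ≤ edist x z) :
    infEDist x E ^ (γ - 1) * thickKernel E t x z ≤
      2⁻¹ ^ (γ - 1) * (1 + 2⁻¹ ^ (-t)) * r ^ (t + 1 - (finrank ℝ V : ℝ)) *
        edist x z ^ (-(1 + t - γ)) := by
  set n : ℝ := (finrank ℝ V : ℝ)
  by_cases hx : edist x z ≤ 2 * infEDist x E
  swap
  · rw [thickKernel, indicator_of_notMem (by simpa using hx), mul_zero]
    exact zero_le
  set e := edist x z
  have he₀ : e ≠ 0 := ((pos_iff_ne_zero.2 hr).trans_le hxz).ne'
  have he_top : e ≠ ∞ := edist_ne_top _ _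
  have hxE : 2⁻¹ * e ≤ infEDist x E := by rwa [ENNReal.inv_mul_le_iff (by simp) (by simp)]
  have hker : thickKernel E t x z ≤ (1 + 2⁻¹ ^ (-t)) * (e ^ (-t) * r ^ (t + 1 - n)) := by
    rw [thickKernel, indicator_of_mem (by exact hx), add_mul, one_mul]
    refine add_le_add ?_ ?_
    · calc e ^ (1 - n) = e ^ (-t) * e ^ (t + 1 - n) := by
            rw [← ENNReal.rpow_add _ _ he₀ he_top]; ring_nf
        _ ≤ e ^ (-t) * r ^ (t + 1 - n) :=
            mul_le_mul_right (ennreal_rpow_le_rpow_of_nonpos (by linarith) hxz) _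
    · rw [← mul_assoc, ← ENNReal.mul_rpow_of_ne_zero (by simp) he₀]
      exact mul_le_mul' (ennreal_rpow_le_rpow_of_nonpos (by linarith) hxE)
        (ennreal_rpow_le_rpow_of_nonpos (by linarith) hz)
  calc infEDist x E ^ (γ - 1) * thickKernel E t x z
      ≤ (2⁻¹ * e) ^ (γ - 1) * ((1 + 2⁻¹ ^ (-t)) * (e ^ (-t) * r ^ (t + 1 - n))) :=
        mul_le_mul' (ennreal_rpow_le_rpow_of_nonpos (by linarith) hxE) hker
    _ = 2⁻¹ ^ (γ - 1) * (1 + 2⁻¹ ^ (-t)) * r ^ (t + 1 - n) * (e ^ (γ - 1) * e ^ (-t)) := by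
        rw [ENNReal.mul_rpow_of_ne_zero (by simp) he₀]; ring
    _ = 2⁻¹ ^ (γ - 1) * (1 + 2⁻¹ ^ (-t)) * r ^ (t + 1 - n) * e ^ (-(1 + t - γ)) := by
        rw [← ENNReal.rpow_add _ _ he₀ he_top]; ring_nf

variable [MeasurableSpace V] [BorelSpace V]

theorem measurable_thickKernel [SecondCountableTopology V] (E : Set V) (t : ℝ) :
    Measurable (Function.uncurry (thickKernel E t)) := by
  have hS : MeasurableSet {p : V × V | edist p.1 p.2 ≤ 2 * infEDist p.1 E} :=
    measurableSet_le (by fun_prop) (by fun_prop)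
  exact Measurable.indicator (f := fun p : V × V ↦ edist p.1 p.2 ^ (1 - (finrank ℝ V : ℝ)) +
    infEDist p.1 E ^ (-t) * infEDist p.2 E ^ (t + 1 - (finrank ℝ V : ℝ))) (by fun_prop) hS

theorem setLIntegral_mul_add_le_lintegral_mul_thickKernel (μ : Measure V) {g I : V → ℝ≥0∞}
    {C : ℝ≥0∞} {x : V} (hC : C ≠ ∞) (hI : ∀ z, g z ≠ 0 →
      I z ≤ C * (infEDist x E ^ (-t) * infEDist z E ^ (t + 1 - (finrank ℝ V : ℝ)))) :
    ∫⁻ z in closedEBall x (2 * infEDist x E),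
        g z * (edist x z ^ (1 - (finrank ℝ V : ℝ)) + I z) ∂μ ≤
      (C + 1) * ∫⁻ z, g z * thickKernel E t x z ∂μ := by
  rw [← lintegral_const_mul' _ _ (by finiteness)]
  refine (setLIntegral_mono_ae' ?_ ?_).trans (setLIntegral_le_lintegral _ _)
  · exact isClosed_closedEBall.measurableSet
  refine .of_forall fun z hz ↦ ?_
  rw [mem_closedEBall, edist_comm] at hz
  rw [thickKernel, indicator_of_mem (by exact hz), mul_left_comm]
  rcases eq_or_ne (g z) 0 with hg | hg
  · simp [hg]
  gcongr
  calc _ ≤ edist x z ^ (1 - (finrank ℝ V : ℝ)) +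
        C * (infEDist x E ^ (-t) * infEDist z E ^ (t + 1 - (finrank ℝ V : ℝ))) := by
        gcongr
        exact hI z hg
    _ ≤ _ := by
        rw [mul_add]
        exact add_le_add (le_mul_of_one_le_left' le_add_self) (mul_le_mul_left le_self_add _)

variable [FiniteDimensional ℝ V] (μ : Measure V) [μ.IsAddHaarMeasure]

theorem setLIntegral_closedEBall_infEDist_rpow_mul_thickKernel_le [Nontrivial V] {z : V}
    {r : ℝ≥0∞} {γ : ℝ} (hr : r ≠ 0) (hr' : r ≠ ∞) (hγ : γ ≤ 1) (ht : 0 ≤ t)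
    (htn : t ≤ (finrank ℝ V : ℝ) - 1) (hz : 2 * r ≤ infEDist z E) :
    ∫⁻ x in closedEBall z r, infEDist x E ^ (γ - 1) * thickKernel E t x z ∂μ ≤
      2 * (dyadicConst (finrank ℝ V) (finrank ℝ V - 1) * μ (ball 0 1)) * r ^ γ := by
  calc _ ≤ ∫⁻ x in closedEBall z r,
          2 * (infEDist x E ^ (γ - 1) * edist x z ^ (1 - (finrank ℝ V : ℝ))) ∂μ := by
        refine setLIntegral_mono (by fun_prop) fun x hx ↦ ?_
        rw [mul_left_comm]
        exact mul_le_mul_right (thickKernel_le_of_edist_le hr hr' ht htn hz hx) _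
    _ ≤ _ := by
        rw [lintegral_const_mul _ (by fun_prop), mul_assoc 2]
        gcongr
        exact setLIntegral_closedEBall_infEDist_rpow_mul_edist_rpow_le μ hγ hr hr' hz

theorem setLIntegral_compl_closedEBall_infEDist_rpow_mul_thickKernel_le {z : V} {r : ℝ≥0∞} {γ : ℝ}
    (hr : r ≠ 0) (hr' : r ≠ ∞) (hγ : γ ≤ 1) (ht : 0 ≤ t) (htn : t ≤ (finrank ℝ V : ℝ) - 1)
    (htγ : (finrank ℝ V : ℝ) - 1 + γ < t) (hz : r ≤ infEDist z E) :
    ∫⁻ x in (closedEBall z r)ᶜ, infEDist x E ^ (γ - 1) * thickKernel E t x z ∂μ ≤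
      2⁻¹ ^ (γ - 1) * (1 + 2⁻¹ ^ (-t)) *
        (dyadicConst (finrank ℝ V) (1 + t - γ) * μ (ball 0 1)) * r ^ γ := by
  set n : ℝ := (finrank ℝ V : ℝ)
  set c : ℝ≥0∞ := 2⁻¹ ^ (γ - 1) * (1 + 2⁻¹ ^ (-t))
  calc _ ≤ ∫⁻ x in {x | r ≤ edist x z}, infEDist x E ^ (γ - 1) * thickKernel E t x z ∂μ :=
        lintegral_mono_set fun x (hx : ¬ edist x z ≤ r) ↦ (not_le.1 hx).le
    _ ≤ ∫⁻ x in {x | r ≤ edist x z},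
          c * r ^ (t + 1 - n) * edist x z ^ (-(1 + t - γ)) ∂μ :=
        setLIntegral_mono (by fun_prop) fun x hx ↦
          infEDist_rpow_mul_thickKernel_le_of_le_edist hr hγ ht htn hz hx
    _ ≤ c * r ^ (t + 1 - n) *
          (dyadicConst n (1 + t - γ) * μ (ball 0 1) * r ^ (n - (1 + t - γ))) := by
        rw [lintegral_const_mul _ (by fun_prop)]
        gcongr
        exact setLIntegral_rpow_neg_far_le (by linarith) (by linarith) hr hr'
          fun R _ hR ↦ (addHaar_closedEBall μ z hR).le
    _ = c * (dyadicConst n (1 + t - γ) * μ (ball 0 1)) *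
          (r ^ (t + 1 - n) * r ^ (n - (1 + t - γ))) := by ring
    _ = c * (dyadicConst n (1 + t - γ) * μ (ball 0 1)) * r ^ γ := by
        rw [← ENNReal.rpow_add _ _ hr hr']
        ring_nf

theorem exists_lintegral_infEDist_rpow_mul_thickKernel_le [Nontrivial V] {γ : ℝ} (hγ : γ < 0)
    (ht : 0 ≤ t) (htn : t ≤ (finrank ℝ V : ℝ) - 1) (htγ : (finrank ℝ V : ℝ) - 1 + γ < t) :
    ∃ C : ℝ≥0∞, C ≠ ∞ ∧ ∀ E : Set V, E.Nonempty → ∀ z : V,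
      ∫⁻ x, infEDist x E ^ (γ - 1) * thickKernel E t x z ∂μ ≤ C * infEDist z E ^ γ := by
  set n : ℝ := (finrank ℝ V : ℝ)
  have hω : μ (ball 0 1) ≠ ∞ := measure_ball_lt_top.ne
  have hκ₁ : dyadicConst n (n - 1) ≠ ∞ := dyadicConst_ne_top (by linarith)
  have hκ₂ : dyadicConst n (1 + t - γ) ≠ ∞ := dyadicConst_ne_top (by linarith)
  have htwo (c : ℝ) : (2⁻¹ : ℝ≥0∞) ^ c ≠ ∞ := ENNReal.rpow_ne_top_of_ne_zero (by simp) (by simp)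
  have ht' := htwo (-t)
  have hγ' := htwo γ
  have hγ₁ := htwo (γ - 1)
  -- The added `1` makes the constant positive, so that the right side is `∞` when `z ∈ closure E`.
  refine ⟨(2 * (dyadicConst n (n - 1) * μ (ball 0 1)) + 2⁻¹ ^ (γ - 1) * (1 + 2⁻¹ ^ (-t)) *
    (dyadicConst n (1 + t - γ) * μ (ball 0 1))) * 2⁻¹ ^ γ + 1, by finiteness, fun E hE z ↦ ?_⟩
  rcases eq_or_ne (infEDist z E) 0 with hδ₀ | hδ₀
  · rw [hδ₀, ENNReal.zero_rpow_of_neg hγ, ENNReal.mul_top (by simp)]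
    exact le_top
  set r := 2⁻¹ * infEDist z E
  have hr : r ≠ 0 := mul_ne_zero (by simp) hδ₀
  have hr' : r ≠ ∞ := ENNReal.mul_ne_top (by simp) (infEDist_ne_top hE)
  have hrE : 2 * r = infEDist z E := ENNReal.mul_inv_cancel_left two_ne_zero (by simp)
  rw [← lintegral_add_compl _ (isClosed_closedEBall (a := z) (r := r)).measurableSet]
  refine (add_le_add
    (setLIntegral_closedEBall_infEDist_rpow_mul_thickKernel_le μ hr hr' (by linarith) ht htn hrE.le)
    (setLIntegral_compl_closedEBall_infEDist_rpow_mul_thickKernel_le μ hr hr' (by linarith) ht htn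
      htγ (hrE ▸ le_mul_of_one_le_left' one_le_two))).trans ?_
  rw [← add_mul, ENNReal.mul_rpow_of_ne_zero (by simp) hδ₀, ← mul_assoc]
  gcongr
  exact le_self_add

theorem setLIntegral_enorm_le_of_ae_eq_zero [Nontrivial V] {v : V → ℝ} {K : ℝ≥0} {B : Set V}
    {ρ : ℝ≥0∞} {m : Measure V} [IsProbabilityMeasure m] (hB : MeasurableSet B)
    (hconv : Convex ℝ B) (hρ₀ : ρ ≠ 0) (hρ_top : ρ ≠ ∞)
    (hρ : ∀ w ∈ B, ∀ y ∈ B, edist w y ≤ ρ) (hv : LipschitzWith K v)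
    (hm : ∀ᵐ w ∂m, w ∈ B ∧ v w = 0) :
    ∫⁻ y in B, ‖v y‖ₑ ∂μ ≤ dyadicConst 1 (finrank ℝ V + 1) * ρ ^ (finrank ℝ V : ℝ) *
      ∫⁻ z in B, ‖fderiv ℝ v z‖ₑ * ∫⁻ w, edist w z ^ (1 - (finrank ℝ V : ℝ)) ∂m ∂μ := by
  set n : ℝ := (finrank ℝ V : ℝ)
  set g : V → ℝ≥0∞ := fun z ↦ ‖fderiv ℝ v z‖ₑ
  set A := dyadicConst 1 (n + 1) * ρ ^ n
  have hg : Measurable g := (measurable_fderiv ℝ v).enorm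
  have hgk : Measurable (Function.uncurry fun w z : V ↦ g z * edist w z ^ (1 - n)) :=
    (hg.comp measurable_snd).mul (by fun_prop)
  calc ∫⁻ y in B, ‖v y‖ₑ ∂μ = ∫⁻ _, ∫⁻ y in B, ‖v y‖ₑ ∂μ ∂m := by simp
    _ ≤ ∫⁻ w, A * ∫⁻ z in B, g z * edist w z ^ (1 - n) ∂μ ∂m := by
        refine lintegral_mono_ae (hm.mono fun w hw ↦ ?_)
        simpa only [hw.2, zero_sub, enorm_neg] using
          setLIntegral_enorm_sub_le μ hB hconv hw.1 hρ₀ hρ_top (hρ w hw.1) hv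
    _ = A * ∫⁻ w, ∫⁻ z in B, g z * edist w z ^ (1 - n) ∂μ ∂m :=
        lintegral_const_mul _ hgk.lintegral_prod_right'
    _ = A * ∫⁻ z in B, g z * ∫⁻ w, edist w z ^ (1 - n) ∂m ∂μ := by
        rw [lintegral_lintegral_swap hgk.aemeasurable]
        congr 1
        exact lintegral_congr fun z ↦ lintegral_const_mul _ (by fun_prop)

theorem enorm_mul_measure_le_of_ae_eq_zero [Nontrivial V] {v : V → ℝ} {K : ℝ≥0} {B : Set V}
    {ρ : ℝ≥0∞} {x : V} {m : Measure V} [IsProbabilityMeasure m] (hB : MeasurableSet B)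
    (hconv : Convex ℝ B) (hρ₀ : ρ ≠ 0) (hρ_top : ρ ≠ ∞)
    (hρ : ∀ w ∈ B, ∀ y ∈ B, edist w y ≤ ρ) (hv : LipschitzWith K v)
    (hm : ∀ᵐ w ∂m, w ∈ B ∧ v w = 0) (hx : x ∈ B) :
    ‖v x‖ₑ * μ B ≤ dyadicConst 1 (finrank ℝ V + 1) * ρ ^ (finrank ℝ V : ℝ) *
      ∫⁻ z in B, ‖fderiv ℝ v z‖ₑ * (edist x z ^ (1 - (finrank ℝ V : ℝ)) +
        ∫⁻ w, edist w z ^ (1 - (finrank ℝ V : ℝ)) ∂m) ∂μ := by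
  set n : ℝ := (finrank ℝ V : ℝ)
  set g : V → ℝ≥0∞ := fun z ↦ ‖fderiv ℝ v z‖ₑ
  set A := dyadicConst 1 (n + 1) * ρ ^ n
  have hg : Measurable g := (measurable_fderiv ℝ v).enorm
  calc ‖v x‖ₑ * μ B = ∫⁻ _ in B, ‖v x‖ₑ ∂μ := (setLIntegral_const _ _).symm
    _ ≤ ∫⁻ y in B, (‖v x - v y‖ₑ + ‖v y‖ₑ) ∂μ := lintegral_mono fun y ↦ by
        simpa using enorm_add_le (v x - v y) (v y)
    _ = ∫⁻ y in B, ‖v x - v y‖ₑ ∂μ + ∫⁻ y in B, ‖v y‖ₑ ∂μ :=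
        lintegral_add_right _ hv.continuous.measurable.enorm
    _ ≤ A * ∫⁻ z in B, g z * edist x z ^ (1 - n) ∂μ +
          A * ∫⁻ z in B, g z * ∫⁻ w, edist w z ^ (1 - n) ∂m ∂μ :=
        add_le_add (setLIntegral_enorm_sub_le μ hB hconv hx hρ₀ hρ_top (hρ x hx) hv)
          (setLIntegral_enorm_le_of_ae_eq_zero μ hB hconv hρ₀ hρ_top hρ hv hm)
    _ = A * ∫⁻ z in B, g z * (edist x z ^ (1 - n) + ∫⁻ w, edist w z ^ (1 - n) ∂m) ∂μ := by
        simp only [mul_add]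
        rw [lintegral_add_left (by fun_prop), mul_add]

theorem enorm_le_of_ae_eq_zero [Nontrivial V] {v : V → ℝ} {K : ℝ≥0} {ρ : ℝ≥0∞} {x : V}
    {m : Measure V} [IsProbabilityMeasure m] (hρ₀ : ρ ≠ 0) (hρ_top : ρ ≠ ∞) (hv : LipschitzWith K v)
    (hm : ∀ᵐ w ∂m, w ∈ closedEBall x ρ ∧ v w = 0) :
    ‖v x‖ₑ ≤ (μ (ball 0 1))⁻¹ * (dyadicConst 1 (finrank ℝ V + 1) * 2 ^ (finrank ℝ V : ℝ) *
      ∫⁻ z in closedEBall x ρ, ‖fderiv ℝ v z‖ₑ * (edist x z ^ (1 - (finrank ℝ V : ℝ)) +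
        ∫⁻ w, edist w z ^ (1 - (finrank ℝ V : ℝ)) ∂m) ∂μ) := by
  have hdiam (w : V) (hw : w ∈ closedEBall x ρ) (y : V) (hy : y ∈ closedEBall x ρ) :
      edist w y ≤ 2 * ρ := by
    rw [two_mul]
    exact (edist_triangle_right w y x).trans (add_le_add hw hy)
  refine le_mul_of_mul_addHaar_closedEBall_le μ (x := x) hρ₀ hρ_top
    ((enorm_mul_measure_le_of_ae_eq_zero μ isClosed_closedEBall.measurableSet
      (convex_closedEBall x ρ) (mul_ne_zero two_ne_zero hρ₀) (by finiteness) hdiam hv hm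
      mem_closedEBall_self).trans_eq ?_)
  rw [ENNReal.mul_rpow_of_nonneg _ _ (Nat.cast_nonneg _)]
  ring

theorem LowerAssouadExponent.exists_measure_lintegral_edist_rpow_le {t₀ : ℝ} (hE : IsClosed E)
    (ht : 0 ≤ t) (htt : t < t₀) (htn : t < (finrank ℝ V : ℝ) - 1)
    (h : LowerAssouadExponent E t₀) :
    ∃ C : ℝ≥0∞, C ≠ ∞ ∧ ∀ x, infEDist x E ≠ 0 → infEDist x E < ediam E → ∀ η : ℝ≥0, η ≠ 0 →
      ∃ m : Measure V, IsProbabilityMeasure m ∧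
        (∀ᵐ w ∂m, w ∈ closedEBall x (2 * infEDist x E) ∧ w ∈ E) ∧
        ∀ z, η ≤ infEDist z E → ∫⁻ w, edist w z ^ (1 - (finrank ℝ V : ℝ)) ∂m ≤
          C * (infEDist x E ^ (-t) * infEDist z E ^ (t + 1 - (finrank ℝ V : ℝ))) := by
  obtain ⟨C, hC_top, hC⟩ :=
    h.exists_isFrostmanMeasure_lintegral_edist_rpow_le (b := finrank ℝ V - 1) ht htt htn
  refine ⟨C, hC_top, fun x hx₀ hxE η hη ↦ ?_⟩
  have hE_ne : E.Nonempty := by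
    rw [nonempty_iff_ne_empty]
    rintro rfl
    simp at hxE
  obtain ⟨y, hy, hxy⟩ := hE.exists_infDist_eq_dist hE_ne x
  have hδ : ENNReal.ofReal (infDist x E) = infEDist x E :=
    ENNReal.ofReal_toReal (infEDist_ne_top hE_ne)
  have hδ_pos : 0 < infDist x E := by
    rwa [← ENNReal.ofReal_pos, hδ, pos_iff_ne_zero]
  obtain ⟨m, hm_prob, hmE, hm⟩ := hC y hy (infDist x E) hδ_pos (hδ ▸ hxE) η hη
  refine ⟨m, hm_prob, hmE.mono fun w hw ↦ ⟨?_, hw.1⟩, fun z hz ↦ ?_⟩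
  · rw [mem_closedEBall, two_mul, ← hδ, ← ENNReal.ofReal_add hδ_pos.le hδ_pos.le, edist_dist]
    refine ENNReal.ofReal_le_ofReal ((dist_triangle w y x).trans (add_le_add hw.2 ?_))
    rw [dist_comm, ← hxy]
  · have := hm z hz
    rwa [neg_sub, hδ, mul_assoc, sub_sub_eq_add_sub] at this

theorem LowerAssouadExponent.exists_enorm_le_lintegral_thickKernel [Nontrivial V] {t₀ : ℝ}
    (hE : IsClosed E) (ht : 0 ≤ t) (htt : t < t₀) (htn : t < (finrank ℝ V : ℝ) - 1)
    (h : LowerAssouadExponent E t₀) :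
    ∃ C : ℝ≥0∞, C ≠ ∞ ∧ ∀ v ∈ lipCc Eᶜ, ∀ x, infEDist x E < ediam E →
      ‖v x‖ₑ ≤ C * ∫⁻ z, ‖fderiv ℝ v z‖ₑ * thickKernel E t x z ∂μ := by
  set n : ℝ := (finrank ℝ V : ℝ)
  have hω₀ : μ (ball 0 1) ≠ 0 := (measure_ball_pos μ 0 one_pos).ne'
  have hκ : dyadicConst 1 (n + 1) ≠ ∞ := dyadicConst_ne_top (by linarith)
  obtain ⟨C, hC_top, hC⟩ := h.exists_measure_lintegral_edist_rpow_le hE ht htt htn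
  refine ⟨(μ (ball 0 1))⁻¹ * (dyadicConst 1 (n + 1) * 2 ^ n * (C + 1)), by finiteness, ?_⟩
  rintro v ⟨⟨K, hv⟩, hv_cpt, hvE⟩ x hxE
  have hzero (w : V) (hw : w ∈ E) : v w = 0 :=
    image_eq_zero_of_notMem_tsupport fun hw' ↦ hvE hw' hw
  by_cases hx : x ∈ E
  · simp [hzero x hx]
  have hδ₀ : infEDist x E ≠ 0 := fun h₀ ↦ hx (hE.closure_eq ▸ mem_closure_iff_infEDist_zero.2 h₀)
  obtain ⟨η, hη_pos, hη⟩ := exists_pos_forall_lt_edist hv_cpt.isCompact hE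
    (disjoint_left.2 fun _ hz ↦ hvE hz)
  obtain ⟨m, hm_prob, hmE, hm⟩ := hC x hδ₀ hxE η hη_pos.ne'
  have hm' (z : V) (hz : ‖fderiv ℝ v z‖ₑ ≠ 0) :
      ∫⁻ w, edist w z ^ (1 - n) ∂m ≤ C * (infEDist x E ^ (-t) * infEDist z E ^ (t + 1 - n)) := by
    refine hm z (le_infEDist.2 fun w hw ↦ (hη z (support_fderiv_subset ℝ fun h₀ ↦ hz ?_) w hw).le)
    rw [h₀]
    exact enorm_zero (E := V →L[ℝ] ℝ)
  refine (enorm_le_of_ae_eq_zero μ (mul_ne_zero two_ne_zero hδ₀)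
    (ENNReal.mul_ne_top (by simp) hxE.ne_top) hv
    (hmE.mono fun w hw ↦ ⟨hw.1, hzero w hw.2⟩)).trans ?_
  simp only [mul_assoc]
  gcongr
  exact setLIntegral_mul_add_le_lintegral_mul_thickKernel μ hC_top hm'

end Thick

theorem measure_support_ne_top_of_mem_lipCc {X : Type*} [PseudoMetricSpace X] [MeasurableSpace X]
    {μ : Measure X} [IsFiniteMeasureOnCompacts μ] {Ω : Set X} {v : X → ℝ} (hv : v ∈ lipCc Ω) :
    μ (Function.support v) ≠ ∞ :=
  measure_ne_top_of_subset (subset_tsupport v) hv.2.1.isCompact.measure_ne_top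

theorem infEDist_rpow_le_of_ediam_le {X : Type*} [PseudoMetricSpace X] {E : Set X} {x y : X}
    {c : ℝ} (hc : c ≤ 0) (hy : y ∈ E) (hx : ediam E ≤ infEDist x E) :
    infEDist x E ^ c ≤ 2⁻¹ ^ c * infEDist x {y} ^ c := by
  have hxy : edist x y ≤ 2 * infEDist x E := by
    rw [two_mul]
    exact (edist_le_infEDist_add_ediam hy).trans (by gcongr)
  rw [infEDist_singleton, ← ENNReal.mul_rpow_of_ne_top (by simp) (edist_ne_top _ _)]
  refine ennreal_rpow_le_rpow_of_nonpos hc ?_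
  rwa [ENNReal.inv_mul_le_iff (by simp) (by simp)]

section L1Hardy

variable {V : Type*} [NormedAddCommGroup V] [NormedSpace ℝ V] [MeasurableSpace V] {μ : Measure V}
  {E : Set V} {γ : ℝ}

theorem L1HardyFor.mono {A : Set V} {𝓕 𝓖 : Set (V → ℝ)} (h : L1HardyFor μ γ A 𝓖) (h𝓕 : 𝓕 ⊆ 𝓖) :
    L1HardyFor μ γ A 𝓕 :=
  h.imp fun _ hC ↦ ⟨hC.1, fun v hv ↦ hC.2 v (h𝓕 hv)⟩

theorem setLIntegral_enorm_mul_infEDist_rpow_le_of_subset {A B S : Set V} {v : V → ℝ}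
    {C D : ℝ≥0∞} (hγ : γ ≤ 0) (hAB : A ⊆ B) (hS : MeasurableSet S) (hD : D ≠ ∞)
    (hSAB : ∀ x ∈ S, infEDist x B ^ (γ - 1) ≤ D * infEDist x A ^ (γ - 1))
    (hA : ∫⁻ x, ‖v x‖ₑ * infEDist x A ^ (γ - 1) ∂μ ≤
      C * ∫⁻ x, ‖fderiv ℝ v x‖ₑ * infEDist x A ^ γ ∂μ) :
    ∫⁻ x in S, ‖v x‖ₑ * infEDist x B ^ (γ - 1) ∂μ ≤
      D * C * ∫⁻ x, ‖fderiv ℝ v x‖ₑ * infEDist x B ^ γ ∂μ := by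
  calc ∫⁻ x in S, ‖v x‖ₑ * infEDist x B ^ (γ - 1) ∂μ
      ≤ ∫⁻ x in S, D * (‖v x‖ₑ * infEDist x A ^ (γ - 1)) ∂μ := by
        refine setLIntegral_mono' hS fun x hx ↦ ?_
        rw [mul_left_comm]
        exact mul_le_mul_right (hSAB x hx) _
    _ ≤ D * ∫⁻ x, ‖v x‖ₑ * infEDist x A ^ (γ - 1) ∂μ := by
        rw [lintegral_const_mul' _ _ hD]
        gcongr
        exact Measure.restrict_le_self
    _ ≤ D * (C * ∫⁻ x, ‖fderiv ℝ v x‖ₑ * infEDist x A ^ γ ∂μ) := by gcongr _ * ?_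
    _ ≤ D * (C * ∫⁻ x, ‖fderiv ℝ v x‖ₑ * infEDist x B ^ γ ∂μ) := by
        gcongr _ * (_ * ?_)
        exact lintegral_mono fun x ↦
          mul_le_mul_right (ennreal_rpow_le_rpow_of_nonpos hγ (infEDist_anti hAB)) _
    _ = D * C * ∫⁻ x, ‖fderiv ℝ v x‖ₑ * infEDist x B ^ γ ∂μ := (mul_assoc _ _ _).symm

variable [BorelSpace V]

theorem L1HardyFor.exists_setLIntegral_ediam_le_infEDist_le {𝓕 : Set (V → ℝ)} {y : V}
    (h : L1HardyFor μ γ {y} 𝓕) (hγ : γ ≤ 0) (hy : y ∈ E) :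
    ∃ C : ℝ≥0∞, C ≠ ∞ ∧ ∀ v ∈ 𝓕,
      ∫⁻ x in {x | ediam E ≤ infEDist x E}, ‖v x‖ₑ * infEDist x E ^ (γ - 1) ∂μ ≤
        C * ∫⁻ x, ‖fderiv ℝ v x‖ₑ * infEDist x E ^ γ ∂μ := by
  obtain ⟨C, hC_top, hC⟩ := h
  have htwo : (2⁻¹ : ℝ≥0∞) ^ (γ - 1) ≠ ∞ := ENNReal.rpow_ne_top_of_ne_zero (by simp) (by simp)
  exact ⟨2⁻¹ ^ (γ - 1) * C, by finiteness, fun v hv ↦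
    setLIntegral_enorm_mul_infEDist_rpow_le_of_subset hγ (singleton_subset_iff.2 hy)
      (measurableSet_le (by fun_prop) (by fun_prop)) htwo
      (fun x hx ↦ infEDist_rpow_le_of_ediam_le (by linarith) hy hx) (hC v hv)⟩

theorem L1HardyFor.union {A B : Set V} {𝓕 𝓖 : Set (V → ℝ)} (hγ : γ ≤ 0) (hA : L1HardyFor μ γ A 𝓕)
    (hB : L1HardyFor μ γ B 𝓖) : L1HardyFor μ γ (A ∪ B) (𝓕 ∩ 𝓖) := by
  obtain ⟨C₁, hC₁_top, hC₁⟩ := hA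
  obtain ⟨C₂, hC₂_top, hC₂⟩ := hB
  refine ⟨1 * C₁ + 1 * C₂, by finiteness, fun v hv ↦ ?_⟩
  have hS : MeasurableSet {x | infEDist x A ≤ infEDist x B} :=
    measurableSet_le (by fun_prop) (by fun_prop)
  rw [← lintegral_add_compl _ hS, add_mul]
  refine add_le_add
    (setLIntegral_enorm_mul_infEDist_rpow_le_of_subset hγ subset_union_left hS ENNReal.one_ne_top
      (fun x hx ↦ ?_) (hC₁ v hv.1))
    (setLIntegral_enorm_mul_infEDist_rpow_le_of_subset hγ subset_union_right hS.compl
      ENNReal.one_ne_top (fun x (hx : ¬infEDist x A ≤ infEDist x B) ↦ ?_) (hC₂ v hv.2))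
  · rw [infEDist_union, min_eq_left hx, one_mul]
  · rw [infEDist_union, min_eq_right (not_le.1 hx).le, one_mul]

theorem LowerAssouadExponent.l1HardyFor [FiniteDimensional ℝ V] [Nontrivial V]
    (μ : Measure V) [μ.IsAddHaarMeasure] {t₀ : ℝ} (hE : IsClosed E)
    (h : LowerAssouadExponent E t₀) (hγ : γ < 0) (hn : 0 < (finrank ℝ V : ℝ) - 1 + γ)
    (ht₀ : (finrank ℝ V : ℝ) - 1 + γ < t₀) : L1HardyFor μ γ E (lipCc Eᶜ) := by
  set n : ℝ := (finrank ℝ V : ℝ)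
  rcases E.eq_empty_or_nonempty with rfl | ⟨y, hy⟩
  · exact ⟨0, by simp, fun v _ ↦ by simp [ENNReal.top_rpow_of_neg (show γ - 1 < 0 by linarith)]⟩
  obtain ⟨t, htγ, ht⟩ := exists_between (lt_min ht₀ (by linarith : n - 1 + γ < n - 1))
  obtain ⟨htt₀, htn⟩ := lt_min_iff.1 ht
  have hsingle : UpperAssouadExponent {y} 0 := ⟨1, le_rfl, fun x _ r R _ _ hR ↦ by simp at hR⟩
  obtain ⟨C₀, hC₀_top, hC₀⟩ :=
    (hsingle.l1HardyFor μ le_rfl hγ hn).exists_setLIntegral_ediam_le_infEDist_le hγ.le hy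
  obtain ⟨C₁, hC₁_top, hC₁⟩ :=
    h.exists_enorm_le_lintegral_thickKernel μ hE (hn.trans htγ).le htt₀ htn
  obtain ⟨C₂, hC₂_top, hC₂⟩ :=
    exists_lintegral_infEDist_rpow_mul_thickKernel_le μ hγ (hn.trans htγ).le htn.le htγ
  refine ⟨C₁ * C₂ + C₀, by finiteness, fun v hv ↦ ?_⟩
  have hS : MeasurableSet {x | infEDist x E < ediam E} :=
    measurableSet_lt (by fun_prop) (by fun_prop)
  have hScompl : {x | infEDist x E < ediam E}ᶜ = {x | ediam E ≤ infEDist x E} := by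
    ext x
    simp
  rw [← lintegral_add_compl _ hS, add_mul, hScompl]
  refine add_le_add ?_ (hC₀ v ⟨hv.1, measure_support_ne_top_of_mem_lipCc hv⟩)
  exact lintegral_mul_le_of_le_lintegral_kernel (measurable_thickKernel E t) (by fun_prop)
    (measurable_fderiv ℝ v).enorm (by fun_prop)
    ((ae_restrict_iff' hS).2 (.of_forall fun x hx ↦ hC₁ v hv x hx))
    fun z ↦ (setLIntegral_le_lintegral _ _).trans (hC₂ E ⟨y, hy⟩ z)

end L1Hardy

theorem ennreal_rpow_mul_mul_rpow_le {p β : ℝ} (hp : 1 < p) (hβ : β < p - 1) (u g : ℝ≥0∞)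
    {d : ℝ≥0∞} (hd : d ≠ 0) :
    u ^ (p - 1) * g * d ^ (β - p + 1) ≤
      (u ^ p * d ^ (β - p)) ^ (1 - 1 / p) * (g ^ p * d ^ β) ^ (1 / p) := by
  rcases eq_or_ne d ∞ with rfl | hd'
  · simp [ENNReal.top_rpow_of_neg (show β - p + 1 < 0 by linarith)]
  have hp_pos : 0 < p := by linarith
  have hp_inv : 0 ≤ 1 - 1 / p := sub_nonneg.2 ((div_le_one hp_pos).2 hp.le)
  have hu_exp : p * (1 - 1 / p) = p - 1 := by field_simp
  have hd_exp : β - p + 1 = (β - p) * (1 - 1 / p) + β * (1 / p) := by field_simp; ring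
  rw [ENNReal.mul_rpow_of_nonneg _ _ hp_inv, ENNReal.mul_rpow_of_nonneg _ _ (by positivity)]
  simp only [← ENNReal.rpow_mul]
  rw [hu_exp, mul_one_div_cancel hp_pos.ne', ENNReal.rpow_one, hd_exp,
    ENNReal.rpow_add _ _ hd hd', mul_mul_mul_comm]

theorem lintegral_rpow_mul_mul_rpow_le {α : Type*} [MeasurableSpace α] {μ : Measure α} {p β : ℝ}
    (hp : 1 < p) (hβ : β < p - 1) {u g d : α → ℝ≥0∞} (hu : Measurable u) (hg : Measurable g)
    (hd : Measurable d) (hd₀ : ∀ᵐ x ∂μ, d x ≠ 0) :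
    ∫⁻ x, u x ^ (p - 1) * g x * d x ^ (β - p + 1) ∂μ ≤
      (∫⁻ x, u x ^ p * d x ^ (β - p) ∂μ) ^ (1 - 1 / p) *
        (∫⁻ x, g x ^ p * d x ^ β ∂μ) ^ (1 / p) := by
  have hp_pos : 0 < p := by linarith
  refine (lintegral_mono_ae (hd₀.mono fun x hx ↦
    ennreal_rpow_mul_mul_rpow_le hp hβ (u x) (g x) hx)).trans ?_
  exact ENNReal.lintegral_mul_norm_pow_le (by fun_prop) (by fun_prop)
    (sub_nonneg.2 ((div_le_one hp_pos).2 hp.le)) (by positivity) (by ring)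

theorem ennreal_le_rpow_mul_of_le_mul_rpow_mul_rpow {p : ℝ} (hp : 0 < p) {a b D : ℝ≥0∞}
    (ha : a ≠ ∞) (h : a ≤ D * (a ^ (1 - 1 / p) * b ^ (1 / p))) : a ≤ D ^ p * b := by
  rcases eq_or_ne a 0 with rfl | ha₀
  · exact zero_le
  have hroot : a ^ (1 / p) ≤ D * b ^ (1 / p) := by
    have ha_pow : a ^ (1 - 1 / p) ≠ 0 := (ENNReal.rpow_pos (pos_iff_ne_zero.2 ha₀) ha).ne'
    rwa [← ENNReal.mul_le_mul_iff_right ha_pow (ENNReal.rpow_ne_top_of_ne_zero ha₀ ha),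
      ← ENNReal.rpow_add _ _ ha₀ ha, sub_add_cancel, ENNReal.rpow_one, mul_left_comm]
  calc a = (a ^ (1 / p)) ^ p := by
        rw [← ENNReal.rpow_mul, one_div_mul_cancel hp.ne', ENNReal.rpow_one]
    _ ≤ (D * b ^ (1 / p)) ^ p := by gcongr
    _ = D ^ p * b := by
        rw [ENNReal.mul_rpow_of_nonneg _ _ hp.le, ← ENNReal.rpow_mul, one_div_mul_cancel hp.ne',
          ENNReal.rpow_one]

theorem lintegral_eq_setLIntegral_of_ae {α : Type*} [MeasurableSpace α] {μ : Measure α}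
    {f : α → ℝ≥0∞} {s : Set α} (hs : MeasurableSet s) (h : ∀ᵐ x ∂μ, x ∉ s → f x = 0) :
    ∫⁻ x, f x ∂μ = ∫⁻ x in s, f x ∂μ := by
  rw [← lintegral_indicator hs]
  refine lintegral_congr_ae (h.mono fun x hx ↦ ?_)
  by_cases hxs : x ∈ s
  · rw [indicator_of_mem hxs]
  · rw [indicator_of_notMem hxs, hx hxs]

theorem ae_notMem_of_setLIntegral_infEDist_rpow_ne_top {X : Type*} [PseudoEMetricSpace X]
    [MeasurableSpace X] [OpensMeasurableSpace X] {μ : Measure X} {A K : Set X} {c : ℝ} (hc : c < 0)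
    (hK : MeasurableSet K) (h : ∫⁻ x in K, infEDist x A ^ c ∂μ ≠ ∞) :
    ∀ᵐ x ∂μ, x ∈ K → x ∉ A := by
  refine (ae_restrict_iff' hK).1 ((ae_lt_top (by fun_prop) h).mono fun x hx hxA ↦ hx.ne ?_)
  rw [infEDist_zero_of_mem hxA, ENNReal.zero_rpow_of_neg hc]

theorem norm_rpow_mem_lipCc {X : Type*} [PseudoMetricSpace X] {Ω : Set X} {u : X → ℝ} {p : ℝ}
    (hp : 1 < p) (hu : u ∈ lipCc Ω) : (fun x ↦ ‖u x‖ ^ p) ∈ lipCc Ω := by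
  obtain ⟨⟨K, hK⟩, hu_supp, huΩ⟩ := hu
  have hsub : tsupport (fun x ↦ ‖u x‖ ^ p) ⊆ tsupport u := closure_mono fun x hx hx₀ ↦ hx <| by
    simp [hx₀, Real.zero_rpow (by linarith : p ≠ 0)]
  refine ⟨?_, hu_supp.of_isClosed_subset isClosed_closure hsub, hsub.trans huΩ⟩
  obtain ⟨M, hM⟩ := hu_supp.exists_bound_of_continuous hK.continuous
  obtain ⟨L, hL⟩ := (contDiff_norm_rpow (E := ℝ) hp).contDiffOn.exists_lipschitzOnWith one_ne_zero
    (convex_closedBall (0 : ℝ) M) (isCompact_closedBall 0 M)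
  exact ⟨L * K, lipschitzOnWith_univ.1 <|
    hL.comp hK.lipschitzOnWith fun x _ ↦ by simpa using hM x⟩

theorem lintegral_enorm_mul_ne_top_of_mem_lipCc {X : Type*} [PseudoMetricSpace X]
    [MeasurableSpace X] [OpensMeasurableSpace X] {μ : Measure X} {Ω : Set X} {u : X → ℝ}
    {w : X → ℝ≥0∞} (hw : ∀ K ⊆ Ω, IsCompact K → ∫⁻ x in K, w x ∂μ ≠ ∞) (hu : u ∈ lipCc Ω) :
    ∫⁻ x, ‖u x‖ₑ * w x ∂μ ≠ ∞ := by
  obtain ⟨⟨L, hL⟩, hu_supp, huΩ⟩ := hu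
  obtain ⟨M, hM⟩ := hu_supp.exists_bound_of_continuous hL.continuous
  refine ne_top_of_le_ne_top (ENNReal.mul_ne_top ENNReal.ofReal_ne_top
    (hw _ huΩ hu_supp.isCompact)) (b := ENNReal.ofReal M * _) ?_
  calc ∫⁻ x, ‖u x‖ₑ * w x ∂μ = ∫⁻ x in tsupport u, ‖u x‖ₑ * w x ∂μ := by
        refine lintegral_eq_setLIntegral_of_ae isClosed_closure.measurableSet (.of_forall ?_)
        intro x hx
        rw [image_eq_zero_of_notMem_tsupport hx, enorm_zero, zero_mul]
    _ ≤ ∫⁻ x in tsupport u, ENNReal.ofReal M * w x ∂μ := by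
        gcongr with x
        rw [← ofReal_norm]
        exact ENNReal.ofReal_le_ofReal (hM x)
    _ = _ := lintegral_const_mul' _ _ ENNReal.ofReal_ne_top

theorem enorm_fderiv_norm_rpow_le_of_differentiableAt {V : Type*} [NormedAddCommGroup V]
    [NormedSpace ℝ V] {u : V → ℝ} {x : V} {p : ℝ} (hp : 1 < p) (hu : DifferentiableAt ℝ u x) :
    ‖fderiv ℝ (fun x ↦ ‖u x‖ ^ p) x‖ₑ ≤
      ENNReal.ofReal p * (‖u x‖ₑ ^ (p - 1) * ‖fderiv ℝ u x‖ₑ) := by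
  have hchain : fderiv ℝ (fun x ↦ ‖u x‖ ^ p) x =
      (fderiv ℝ (fun t : ℝ ↦ ‖t‖ ^ p) (u x)).comp (fderiv ℝ u x) :=
    fderiv_comp x (g := fun t : ℝ ↦ ‖t‖ ^ p) (differentiable_norm_rpow hp _) hu
  have hnorm : ‖fderiv ℝ (fun x ↦ ‖u x‖ ^ p) x‖ ≤ p * (‖u x‖ ^ (p - 1) * ‖fderiv ℝ u x‖) := by
    rw [hchain, ← mul_assoc, ← norm_fderiv_norm_id_rpow _ hp]
    exact ContinuousLinearMap.opNorm_comp_le _ _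
  rw [← ofReal_norm, ← ofReal_norm, ← ofReal_norm,
    ENNReal.ofReal_rpow_of_nonneg (norm_nonneg _) (by linarith),
    ← ENNReal.ofReal_mul (by positivity), ← ENNReal.ofReal_mul (by linarith)]
  exact ENNReal.ofReal_le_ofReal hnorm

section Lp

variable {V : Type*} [NormedAddCommGroup V] [NormedSpace ℝ V] [FiniteDimensional ℝ V]
  [MeasurableSpace V] [BorelSpace V] {μ : Measure V} [μ.IsAddHaarMeasure] {A Ω : Set V}

theorem lintegral_enorm_fderiv_norm_rpow_mul_le {p β : ℝ} (hp : 1 < p) (hβ : β < p - 1)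
    (hA : IsClosed A) {u : V → ℝ} {K : ℝ≥0} (hu : LipschitzWith K u)
    (huA : ∀ᵐ x ∂μ, x ∈ tsupport u → x ∉ A) :
    ∫⁻ x, ‖fderiv ℝ (fun x ↦ ‖u x‖ ^ p) x‖ₑ * infEDist x A ^ (β - p + 1) ∂μ ≤
      ENNReal.ofReal p * ((∫⁻ x, ‖u x‖ₑ ^ p * infEDist x A ^ (β - p) ∂μ) ^ (1 - 1 / p) *
        (∫⁻ x in Aᶜ, ‖fderiv ℝ u x‖ₑ ^ p * infEDist x A ^ β ∂μ) ^ (1 / p)) := by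
  have hp_inv : 0 ≤ 1 - 1 / p := sub_nonneg.2 ((div_le_one (by linarith)).2 hp.le)
  have hu_meas : Measurable fun x ↦ ‖u x‖ₑ := hu.continuous.measurable.enorm
  have hdist : ∀ᵐ x ∂μ.restrict Aᶜ, infEDist x A ≠ 0 :=
    (ae_restrict_mem hA.measurableSet.compl).mono fun x hx h ↦
      hx ((mem_iff_infEDist_zero_of_closed hA).2 h)
  calc ∫⁻ x, ‖fderiv ℝ (fun x ↦ ‖u x‖ ^ p) x‖ₑ * infEDist x A ^ (β - p + 1) ∂μ
      ≤ ∫⁻ x, ENNReal.ofReal p *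
          (‖u x‖ₑ ^ (p - 1) * ‖fderiv ℝ u x‖ₑ * infEDist x A ^ (β - p + 1)) ∂μ := by
        refine lintegral_mono_ae (hu.ae_differentiableAt.mono fun x hx ↦ ?_)
        rw [← mul_assoc]
        gcongr
        exact enorm_fderiv_norm_rpow_le_of_differentiableAt hp hx
    _ = ENNReal.ofReal p *
          ∫⁻ x, ‖u x‖ₑ ^ (p - 1) * ‖fderiv ℝ u x‖ₑ * infEDist x A ^ (β - p + 1) ∂μ :=
        lintegral_const_mul' _ _ ENNReal.ofReal_ne_top
    _ = ENNReal.ofReal p *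
          ∫⁻ x in Aᶜ, ‖u x‖ₑ ^ (p - 1) * ‖fderiv ℝ u x‖ₑ * infEDist x A ^ (β - p + 1) ∂μ := by
        congr 1
        refine lintegral_eq_setLIntegral_of_ae hA.measurableSet.compl (huA.mono fun x hx hxA ↦ ?_)
        rw [image_eq_zero_of_notMem_tsupport fun h ↦ hxA (hx h), enorm_zero,
          ENNReal.zero_rpow_of_pos (by linarith), zero_mul, zero_mul]
    _ ≤ ENNReal.ofReal p *
          ((∫⁻ x in Aᶜ, ‖u x‖ₑ ^ p * infEDist x A ^ (β - p) ∂μ) ^ (1 - 1 / p) *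
            (∫⁻ x in Aᶜ, ‖fderiv ℝ u x‖ₑ ^ p * infEDist x A ^ β ∂μ) ^ (1 / p)) := by
        gcongr _ * ?_
        exact lintegral_rpow_mul_mul_rpow_le hp hβ hu_meas (measurable_fderiv ℝ u).enorm
          (by fun_prop) hdist
    _ ≤ _ := by
        gcongr
        exact Measure.restrict_le_self

theorem L1HardyFor.exists_lintegral_rpow_le {p β : ℝ} (hp : 1 < p) (hβ : β < p - 1)
    (hA : IsClosed A) (h : L1HardyFor μ (β - p + 1) A (lipCc Ω))
    (hfin : ∀ K ⊆ Ω, IsCompact K → ∫⁻ x in K, infEDist x A ^ (β - p) ∂μ ≠ ∞) :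
    ∃ C : ℝ≥0∞, C ≠ ∞ ∧ ∀ u ∈ lipCc Ω, ∫⁻ x, ‖u x‖ₑ ^ p * infEDist x A ^ (β - p) ∂μ ≤
      C * ∫⁻ x in Aᶜ, ‖fderiv ℝ u x‖ₑ ^ p * infEDist x A ^ β ∂μ := by
  obtain ⟨C, hC_top, hC⟩ := h
  have hp_pos : 0 < p := by linarith
  refine ⟨(C * ENNReal.ofReal p) ^ p, by finiteness, fun u hu ↦ ?_⟩
  have hv := norm_rpow_mem_lipCc hp hu
  have hv_enorm (x : V) : ‖‖u x‖ ^ p‖ₑ = ‖u x‖ₑ ^ p := by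
    rw [Real.enorm_rpow_of_nonneg (norm_nonneg _) hp_pos.le, enorm_norm]
  have hv_fin := lintegral_enorm_mul_ne_top_of_mem_lipCc hfin hv
  have hv_hardy := hC _ hv
  simp only [hv_enorm, add_sub_cancel_right] at hv_fin hv_hardy
  obtain ⟨⟨L, hL⟩, hu_supp, huΩ⟩ := hu
  have huA := ae_notMem_of_setLIntegral_infEDist_rpow_ne_top (by linarith)
    isClosed_closure.measurableSet (hfin _ huΩ hu_supp.isCompact)
  refine ennreal_le_rpow_mul_of_le_mul_rpow_mul_rpow hp_pos hv_fin (hv_hardy.trans ?_)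
  rw [mul_assoc]
  gcongr _ * ?_
  exact lintegral_enorm_fderiv_norm_rpow_mul_le hp hβ hA hL huA

theorem UpperAssouadExponent.setLIntegral_infEDist_union_rpow_neg_ne_top {E F K : Set V} {s b : ℝ}
    (hs : 0 ≤ s) (h : UpperAssouadExponent F s) (hb : 0 ≤ b) (hbs : b < (finrank ℝ V : ℝ) - s)
    (hE : IsClosed E) (hK : IsCompact K) (hKE : K ⊆ Eᶜ) :
    ∫⁻ x in K, infEDist x (E ∪ F) ^ (-b) ∂μ ≠ ∞ := by
  obtain ⟨C, hC_top, hC⟩ := h.exists_setLIntegral_closedEBall_infEDist_rpow_neg_le μ hs hb hbs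
  obtain ⟨η, hη, hKη⟩ :=
    exists_pos_forall_lt_edist hK hE (subset_compl_iff_disjoint_right.1 hKE)
  have hη_pow : (η : ℝ≥0∞) ^ (-b) ≠ ∞ :=
    ENNReal.rpow_ne_top_of_ne_zero (by simpa using hη.ne') ENNReal.coe_ne_top
  obtain ⟨R, hR, hKR⟩ := hK.isBounded.subset_closedBall_lt 0 0
  rw [← closedEBall_ofReal hR.le] at hKR
  have hR₀ : ENNReal.ofReal R ≠ 0 := by simpa using hR
  have hR_pow : ENNReal.ofReal R ^ ((finrank ℝ V : ℝ) - b) ≠ ∞ :=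
    ENNReal.rpow_ne_top_of_ne_zero hR₀ ENNReal.ofReal_ne_top
  have hK_fin : μ K ≠ ∞ := hK.measure_lt_top.ne
  refine ne_top_of_le_ne_top (b := η ^ (-b) * μ K + C * ENNReal.ofReal R ^ ((finrank ℝ V : ℝ) - b))
    (by finiteness) ?_
  calc ∫⁻ x in K, infEDist x (E ∪ F) ^ (-b) ∂μ
      ≤ ∫⁻ x in K, (η ^ (-b) + infEDist x F ^ (-b)) ∂μ := by
        refine setLIntegral_mono' hK.measurableSet fun x hx ↦ ?_
        have hxE : (η : ℝ≥0∞) ≤ infEDist x E := le_infEDist.2 fun y hy ↦ (hKη x hx y hy).le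
        rw [infEDist_union]
        rcases min_choice (infEDist x E) (infEDist x F) with hmin | hmin <;> rw [hmin]
        · exact le_add_right (ennreal_rpow_le_rpow_of_nonpos (neg_nonpos.2 hb) hxE)
        · exact le_add_self
    _ = η ^ (-b) * μ K + ∫⁻ x in K, infEDist x F ^ (-b) ∂μ := by
        rw [lintegral_add_left measurable_const, setLIntegral_const]
    _ ≤ η ^ (-b) * μ K + C * ENNReal.ofReal R ^ ((finrank ℝ V : ℝ) - b) := by
        gcongr
        exact (lintegral_mono_set hKR).trans (hC 0 _ hR₀ ENNReal.ofReal_ne_top)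

theorem LowerAssouadExponent.exists_lintegral_rpow_le_of_union [Nontrivial V] {E F : Set V}
    {s t p β : ℝ} (hE : IsClosed E) (hEt : LowerAssouadExponent E t) (hF : IsClosed F)
    (hFs : UpperAssouadExponent F s) (hs : 0 ≤ s) (hp : 1 < p) (hβ : β < p - 1)
    (hsβ : s < (finrank ℝ V : ℝ) - p + β) (hβt : (finrank ℝ V : ℝ) - p + β < t) :
    ∃ C : ℝ≥0∞, C ≠ ∞ ∧ ∀ u ∈ lipCc Eᶜ,
      ∫⁻ x, ‖u x‖ₑ ^ p * infEDist x (E ∪ F) ^ (β - p) ∂μ ≤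
        C * ∫⁻ x in (E ∪ F)ᶜ, ‖fderiv ℝ u x‖ₑ ^ p * infEDist x (E ∪ F) ^ β ∂μ := by
  have hγ : β - p + 1 < 0 := by linarith
  have hthick := hEt.l1HardyFor μ hE hγ (by linarith) (by linarith)
  have hthin := hFs.l1HardyFor μ hs hγ (by linarith)
  refine L1HardyFor.exists_lintegral_rpow_le hp hβ (hE.union hF)
    ((hthick.union hγ.le hthin).mono fun u hu ↦
      ⟨hu, hu.1, measure_support_ne_top_of_mem_lipCc hu⟩) fun K hKE hK ↦ ?_
  rw [← neg_sub]
  exact hFs.setLIntegral_infEDist_union_rpow_neg_ne_top hs (by linarith) (by linarith) hE hK hKE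

end Lp

section ExtensionByZero

variable {V : Type*} [NormedAddCommGroup V] [NormedSpace ℝ V] {Ω : Set V} {u : V → ℝ} {K : ℝ≥0}

theorem norm_le_mul_dist_of_notMem_of_lipschitzOnWith (hΩ : IsOpen Ω)
    (hu : LipschitzOnWith K u Ω) (hsupp : closure {x | x ∈ Ω ∧ u x ≠ 0} ⊆ Ω) {x y : V}
    (hx : x ∈ Ω) (hy : y ∉ Ω) : ‖u x‖ ≤ K * dist x y := by
  set S := closure {x | x ∈ Ω ∧ u x ≠ 0}
  obtain ⟨z, hz, hzΩ, hzS⟩ := (convex_segment (𝕜 := ℝ) x y).isPreconnected Ω Sᶜ hΩ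
    isClosed_closure.isOpen_compl (fun z _ ↦ (em (z ∈ S)).imp (fun h ↦ hsupp h) id)
    ⟨x, left_mem_segment ℝ x y, hx⟩ ⟨y, right_mem_segment ℝ x y, fun h ↦ hy (hsupp h)⟩
  have huz : u z = 0 := not_not.1 fun h ↦ hzS (subset_closure ⟨hzΩ, h⟩)
  calc ‖u x‖ = dist (u x) (u z) := by rw [huz, dist_zero_right]
    _ ≤ K * dist x z := hu.dist_le_mul x hx z hzΩ
    _ ≤ K * dist x y := by
        rw [← dist_add_dist_of_mem_segment hz]
        gcongr
        exact le_add_of_nonneg_right dist_nonneg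

theorem indicator_mem_lipCc (hΩ : IsOpen Ω) (hu : u ∈ LipZero Ω) : Ω.indicator u ∈ lipCc Ω := by
  obtain ⟨⟨K, hK⟩, hu_comp, huΩ⟩ := hu
  have hsupp : tsupport (Ω.indicator u) = closure {x | x ∈ Ω ∧ u x ≠ 0} := by
    rw [tsupport, support_indicator]
    rfl
  refine ⟨⟨K, LipschitzWith.of_dist_le_mul fun x y ↦ ?_⟩, ?_, hsupp ▸ huΩ⟩
  · by_cases hx : x ∈ Ω <;> by_cases hy : y ∈ Ω
    · rw [indicator_of_mem hx, indicator_of_mem hy]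
      exact hK.dist_le_mul x hx y hy
    · rw [indicator_of_mem hx, indicator_of_notMem hy, dist_zero_right]
      exact norm_le_mul_dist_of_notMem_of_lipschitzOnWith hΩ hK huΩ hx hy
    · rw [indicator_of_notMem hx, indicator_of_mem hy, dist_zero_left, dist_comm]
      exact norm_le_mul_dist_of_notMem_of_lipschitzOnWith hΩ hK huΩ hy hx
    · rw [indicator_of_notMem hx, indicator_of_notMem hy, dist_self]
      positivity
  · rwa [HasCompactSupport, hsupp]

theorem fderiv_indicator_of_mem (hΩ : IsOpen Ω) {x : V} (hx : x ∈ Ω) :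
    fderiv ℝ (Ω.indicator u) x = fderiv ℝ u x :=
  (Filter.eventuallyEq_of_mem (hΩ.mem_nhds hx) fun _ hy ↦ indicator_of_mem hy u).fderiv_eq

end ExtensionByZero

theorem enorm_gradient {H : Type*} [NormedAddCommGroup H] [InnerProductSpace ℝ H] [CompleteSpace H]
    (u : H → ℝ) (x : H) : ‖gradient u x‖ₑ = ‖fderiv ℝ u x‖ₑ := by
  rw [gradient, LinearIsometryEquiv.enorm_map]

theorem corollary7p2_general {V : Type*} [NormedAddCommGroup V] [NormedSpace ℝ V]
    [FiniteDimensional ℝ V] [MeasurableSpace V] [BorelSpace V] (μ : Measure V)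
    [μ.IsAddHaarMeasure] (p β : ℝ) (hp : 1 < p) (hβ : β < p - 1) (Ω₀ F : Set V) (hΩ₀ : IsOpen Ω₀)
    (hthick : (((finrank ℝ V : ℝ) - p + β : ℝ) : EReal) < lowerAssouadDim Ω₀ᶜ) (hF : IsClosed F)
    (hthin : upperAssouadDim F < (((finrank ℝ V : ℝ) - p + β : ℝ) : EReal)) :
    ∃ C : ℝ≥0, 0 < C ∧ ∀ u ∈ LipZero Ω₀,
      ∫⁻ x in Ω₀ \ F, ‖u x‖ₑ ^ p * infEDist x (Ω₀ \ F)ᶜ ^ (β - p) ∂μ ≤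
        C * ∫⁻ x in Ω₀ \ F, ‖fderiv ℝ u x‖ₑ ^ p * infEDist x (Ω₀ \ F)ᶜ ^ β ∂μ := by
  obtain ⟨_, ⟨t, ⟨-, ht⟩, rfl⟩, hβt⟩ := lt_sSup_iff.1 hthick
  obtain ⟨_, ⟨s, ⟨hs, hFs⟩, rfl⟩, hsβ⟩ := sInf_lt_iff.1 hthin
  rw [EReal.coe_lt_coe_iff] at hβt hsβ
  have : Nontrivial V :=
    nontrivial_of_finrank_pos (R := ℝ) (Nat.cast_pos.1 (by linarith : (0 : ℝ) < finrank ℝ V))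
  obtain ⟨C, hC_top, hC⟩ := ht.exists_lintegral_rpow_le_of_union (μ := μ) hΩ₀.isClosed_compl hF hFs
    hs hp hβ hsβ hβt
  lift C to ℝ≥0 using hC_top
  refine ⟨C + 1, by positivity, fun u hu ↦ ?_⟩
  have hΩ : MeasurableSet (Ω₀ \ F) := hΩ₀.measurableSet.diff hF.measurableSet
  have hcompl : (Ω₀ \ F)ᶜ = Ω₀ᶜ ∪ F := by rw [Set.sdiff_eq, compl_inter, compl_compl]
  have hcompl' : (Ω₀ᶜ ∪ F)ᶜ = Ω₀ \ F := by rw [← hcompl, compl_compl]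
  specialize hC (Ω₀.indicator u) (by simpa only [compl_compl] using indicator_mem_lipCc hΩ₀ hu)
  rw [hcompl'] at hC
  rw [hcompl]
  calc ∫⁻ x in Ω₀ \ F, ‖u x‖ₑ ^ p * infEDist x (Ω₀ᶜ ∪ F) ^ (β - p) ∂μ
      = ∫⁻ x in Ω₀ \ F, ‖Ω₀.indicator u x‖ₑ ^ p * infEDist x (Ω₀ᶜ ∪ F) ^ (β - p) ∂μ :=
        setLIntegral_congr_fun hΩ fun x hx ↦ by rw [indicator_of_mem hx.1]
    _ ≤ C * ∫⁻ x in Ω₀ \ F,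
          ‖fderiv ℝ (Ω₀.indicator u) x‖ₑ ^ p * infEDist x (Ω₀ᶜ ∪ F) ^ β ∂μ :=
        (setLIntegral_le_lintegral _ _).trans hC
    _ = C * ∫⁻ x in Ω₀ \ F, ‖fderiv ℝ u x‖ₑ ^ p * infEDist x (Ω₀ᶜ ∪ F) ^ β ∂μ := by
        congr 1
        exact setLIntegral_congr_fun hΩ fun x hx ↦ by rw [fderiv_indicator_of_mem hΩ₀ hx.1]
    _ ≤ _ := by
        gcongr
        exact le_self_add

theorem corollary7p2 (n : ℕ) (p β : ℝ) (hp : 1 < p) (hβ : β < p - 1)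
    (Ω₀ F : Set (EuclideanSpace ℝ (Fin n))) (hΩ₀ : IsOpen Ω₀)
    (hthick : (((n : ℝ) - p + β : ℝ) : EReal) < lowerAssouadDim Ω₀ᶜ)
    (hF : IsClosed F) (hFΩ₀ : F ⊆ closure Ω₀)
    (hthin : upperAssouadDim F < (((n : ℝ) - p + β : ℝ) : EReal)) :
    HardyInequalityFor p β (Ω₀ \ F) (LipZero Ω₀) := by
  simpa only [HardyInequalityFor, enorm_gradient] using
    corollary7p2_general volume p β hp hβ Ω₀ F hΩ₀ (by rwa [finrank_euclideanSpace_fin]) hF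
      (by rwa [finrank_euclideanSpace_fin])
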